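/- **Theorem 2 (second-moment coverage for HCP$^2$).** Let $\mathcal X,\mathcal Y$ be measurable spaces, $P_X$ a probability distribution on $\mathcal X$, and $P_{N|X}$, $P_{Y|X}$ Markov kernels from $\mathcal X$ to $\{0,1,2,\dots\}$ and to $\mathcal Y$. Let $K=K_0+K_1$ with $K_0,K_1\ge 0$, and let the data $\mathcal D=(X_k,Y_{k,1},\dots,Y_{k,N_k})_{k=1,\dots,K}$ be drawn independently for each $k$ from $$X_k\sim P_X,\qquad N_k\mid X_k\sim P_{N|X},\qquad Y_{k,1},\dots,Y_{k,N_k}\mid (X_k,N_k)\overset{\text{iid}}{\sim}P_{Y|X}.$$ Let the test point $X_{\rm test}\sim P_X$, $Y_{\rm test}\mid X_{\rm test}\sim P_{Y|X}$ be independent of $\mathcal D$. Assume $p_{\ge 2}=\mathbb P(N\ge 2)>0$ under $(X,N)\sim P_X\times P_{N|X}$, and let $P_X^{\ge 2}$ be the conditional distribution of $X$ given $N\ge 2$ in this joint model. Let $s:\mathcal X\times\mathcal Y\to\mathbb R$ be a score function fitted on the groups $k=1,\dots,K_0$ (a jointly measurable function of these groups and of $(x,y)$), write $Z_{k,i}=(X_k,Y_{k,i})$,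 and let $s_{k,(1)}\le\dots\le s_{k,(N_k)}$ be the order statistics of $s(Z_{k,1}),\dots,s(Z_{k,N_k})$. Let $K_1^{\ge 2}$ be the number of $k\in\{K_0+1,\dots,K\}$ with $N_k\ge 2$. For $\alpha\in[0,1]$ the HCP$^2$ prediction set is $\widehat C(x)=\{y\in\mathcal Y: s(x,y)\le T\}$, where $$T=Q_{1-\alpha^2}\Bigg(\sum_{\substack{K_0<k\le K\\ N_k\ge 2}}\sum_{i=1}^{N_k}\frac{N_k-i}{(K_1^{\ge 2}+1)\binom{N_k}{2}}\,\delta_{s_{k,(i)}}+\frac{1}{K_1^{\ge 2}+1}\,\delta_{+\infty}\Bigg)$$ and $Q_\beta(P)=\inf\{t: P((-\infty,t])\ge\beta\}$ in the extended reals; equivalently, the inner sum may be replaced by $\sum_{1\le i<i'\le N_k}\frac{1}{(K_1^{\ge 2}+1)\binom{N_k}{2}}\,\delta_{\min\{s(Z_{k,i}),s(Z_{k,i'})\}}$. Let $$\alpha_{\mathcal D}(x)=P_{Y|X=x}\big(\{y: y\notin\widehat C(x)\}\big),$$ so that $\alpha_{\mathcal D}(X_{\rm test})=\mathbb P\big(Y_{\rm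 test}\notin\widehat C(X_{\rm test})\mid\mathcal D,X_{\rm test}\big)$ almost surely. Then, the expectation being over $\mathcal D$ and an independent $X_{\rm test}\sim P_X^{\ge 2}$, $$\mathbb E_{P_X^{\ge 2}}\big[\alpha_{\mathcal D}(X_{\rm test})^2\big]\le\alpha^2 .$$ Moreover, if the scores $s(Z_{k,i})$, $K_0<k\le K$, $1\le i\le N_k$, are almost surely all distinct, then also $$\mathbb E_{P_X^{\ge 2}}\big[\alpha_{\mathcal D}(X_{\rm test})^2\big]\ge\alpha^2-\frac{2}{(K_1+1)\,p_{\ge 2}} .$$ -/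

import Mathlib

open MeasureTheory ProbabilityTheory
open scoped ENNReal

noncomputable section

namespace HCP

/-- One group of repeated measurements: a feature `X`, a number of repeats `N`, and the `N`
responses `Y₁, …, Y_N` observed at this feature. -/
abbrev GroupData (𝒳 𝒴 : Type*) : Type _ := 𝒳 × (Σ n : ℕ, (Fin n → 𝒴))

section Data

variable {𝒳 𝒴 : Type*}

/-- The feature `X` of a group. -/
def GroupData.feature (z : GroupData 𝒳 𝒴) : 𝒳 := z.1

/-- The number `N` of repeated measurements in a group. -/
def GroupData.size (z : GroupData 𝒳 𝒴) : ℕ := z.2.1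

/-- The `i`-th data point `Zᵢ = (X, Yᵢ)` of a group. -/
def GroupData.point (z : GroupData 𝒳 𝒴) (i : Fin z.size) : 𝒳 × 𝒴 := (z.feature, z.2.2 i)

end Data

section Model

variable {𝒳 𝒴 : Type*} [MeasurableSpace 𝒳] [MeasurableSpace 𝒴]

theorem measurable_pi_const (PY : Kernel 𝒳 𝒴) [IsMarkovKernel PY] (n : ℕ) :
    Measurable (fun x : 𝒳 => Measure.pi (fun _ : Fin n => PY x)) := by
  refine Measurable.measure_of_isPiSystem_of_isProbabilityMeasure generateFrom_pi.symm
    isPiSystem_pi ?_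
  rintro _ ⟨s, hs, rfl⟩
  simp only [Measure.pi_pi]
  exact Finset.measurable_prod _ fun i _ => PY.measurable_coe (hs i trivial)

theorem measurable_sigma_mk (n : ℕ) :
    Measurable (fun y : Fin n → 𝒴 => (⟨n, y⟩ : Σ n : ℕ, (Fin n → 𝒴))) :=
  Measurable.of_le_map (iInf_le _ n)

/-- Given `(X, N) = (x, n)`, the responses `Y₁, …, Yₙ` are i.i.d. from `P_{Y|X}` at `x`. -/
def responses (PY : Kernel 𝒳 𝒴) [IsMarkovKernel PY] :
    Kernel (𝒳 × ℕ) (Σ n : ℕ, (Fin n → 𝒴)) where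
  toFun p := (Measure.pi (fun _ : Fin p.2 => PY p.1)).map
    (fun y => (⟨p.2, y⟩ : Σ n : ℕ, (Fin n → 𝒴)))
  measurable' := measurable_from_prod_countable_left fun n =>
    (Measure.measurable_map _ (measurable_sigma_mk n)).comp (measurable_pi_const PY n)

/-- The law of one group: `X ∼ P_X`, then `N ∣ X ∼ P_{N|X}`, then
`Y₁, …, Y_N ∣ (X, N)` i.i.d. from `P_{Y|X}`. -/
def groupLaw (PX : Measure 𝒳) (PN : Kernel 𝒳 ℕ) (PY : Kernel 𝒳 𝒴) [IsMarkovKernel PY] :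
    Measure (GroupData 𝒳 𝒴) :=
  ((PX ⊗ₘ PN) ⊗ₘ responses PY).map (fun p => (p.1.1, p.2))

/-- `p_{≥2} = ℙ(N ≥ 2)` under `(X, N) ∼ P_X × P_{N|X}`. -/
def probTwo (PX : Measure 𝒳) (PN : Kernel 𝒳 ℕ) : ℝ := (PX ⊗ₘ PN).real {p | 2 ≤ p.2}

/-- `P_X^{≥2}`: the conditional law of `X` given `N ≥ 2` under `(X, N) ∼ P_X × P_{N|X}`. -/
def featureLawTwo (PX : Measure 𝒳) (PN : Kernel 𝒳 ℕ) : Measure 𝒳 :=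
  (ProbabilityTheory.cond (PX ⊗ₘ PN) {p | 2 ≤ p.2}).map Prod.fst

end Model

section Method

/-- The `β`-quantile `inf {t : P((-∞, t]) ≥ β}` of a distribution on the extended reals. -/
def quantile (β : ℝ) (P : Measure EReal) : EReal :=
  sInf {t : EReal | β ≤ P.real (Set.Iic t)}

/-- The order statistics `v₍₁₎ ≤ … ≤ v₍ₙ₎` of a tuple, indexed from `0`. -/
def orderStat {n : ℕ} (v : Fin n → ℝ) (i : Fin n) : ℝ := v (Tuple.sort v i)

variable {𝒳 𝒴 : Type*} {K₀ K₁ : ℕ}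

/-- The first `K₀` groups, used to fit the score function. -/
def trainPart (D : Fin (K₀ + K₁) → GroupData 𝒳 𝒴) : Fin K₀ → GroupData 𝒳 𝒴 :=
  fun k => D (Fin.castAdd K₁ k)

/-- The last `K₁` groups, used for calibration. -/
def calPart (D : Fin (K₀ + K₁) → GroupData 𝒳 𝒴) : Fin K₁ → GroupData 𝒳 𝒴 :=
  fun k => D (Fin.natAdd K₀ k)

/-- `K₁^{≥2}`: the number of calibration groups with at least two measurements. -/
def numTwo (cal : Fin K₁ → GroupData 𝒳 𝒴) : ℕ :=
  (Finset.univ.filter fun k => 2 ≤ (cal k).size).card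

/-- The scores `s(Z₁), …, s(Z_N)` of one group. -/
def groupScores (s : 𝒳 × 𝒴 → ℝ) (z : GroupData 𝒳 𝒴) : Fin z.size → ℝ :=
  fun i => s (z.point i)

/-- The distribution
`∑_{k : N_k ≥ 2} ∑_{i ≤ N_k} (N_k - i) / ((K₁^{≥2} + 1) (N_k choose 2)) δ_{s_{k,(i)}}
  + 1 / (K₁^{≥2} + 1) δ_{+∞}`. As `i : Fin N_k` starts from `0`, the weight reads
`N_k - (i + 1)` here. -/
def calMeasure (s : 𝒳 × 𝒴 → ℝ) (cal : Fin K₁ → GroupData 𝒳 𝒴) : Measure EReal :=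
  (∑ k : Fin K₁ with 2 ≤ (cal k).size, ∑ i : Fin (cal k).size,
    ((((cal k).size - (i.val + 1) : ℕ) : ℝ≥0∞) /
      (((numTwo cal : ℝ≥0∞) + 1) * ((cal k).size.choose 2 : ℝ≥0∞))) •
        Measure.dirac ((orderStat (groupScores s (cal k)) i : ℝ) : EReal))
  + (1 / ((numTwo cal : ℝ≥0∞) + 1)) • Measure.dirac (⊤ : EReal)

/-- The threshold `T`, the `(1 - α²)`-quantile of `calMeasure`, where `fit` maps the training
groups to the score function. -/
def threshold (α : ℝ) (fit : (Fin K₀ → GroupData 𝒳 𝒴) → 𝒳 × 𝒴 → ℝ)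
    (D : Fin (K₀ + K₁) → GroupData 𝒳 𝒴) : EReal :=
  quantile (1 - α ^ 2) (calMeasure (fit (trainPart D)) (calPart D))

/-- The HCP² prediction set `Ĉ(x) = {y : s(x, y) ≤ T}`. -/
def predSet (α : ℝ) (fit : (Fin K₀ → GroupData 𝒳 𝒴) → 𝒳 × 𝒴 → ℝ)
    (D : Fin (K₀ + K₁) → GroupData 𝒳 𝒴) (x : 𝒳) : Set 𝒴 :=
  {y | ((fit (trainPart D) (x, y) : ℝ) : EReal) ≤ threshold α fit D}

/-- The conditional miscoverage `α_D(x)`: the probability that `Y_test ∉ Ĉ(x)` for the given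
data, when `Y_test` is drawn from `P_{Y|X}` at `x`. -/
def miscoverage [MeasurableSpace 𝒳] [MeasurableSpace 𝒴] (PY : Kernel 𝒳 𝒴) (α : ℝ)
    (fit : (Fin K₀ → GroupData 𝒳 𝒴) → 𝒳 × 𝒴 → ℝ)
    (D : Fin (K₀ + K₁) → GroupData 𝒳 𝒴) (x : 𝒳) : ℝ :=
  (PY x).real {y | y ∉ predSet α fit D x}

/-- All scores `s(Z_{k,i})` of the calibration groups are distinct. -/
def DistinctScores (fit : (Fin K₀ → GroupData 𝒳 𝒴) → 𝒳 × 𝒴 → ℝ)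
    (D : Fin (K₀ + K₁) → GroupData 𝒳 𝒴) : Prop :=
  Function.Injective fun p : (Σ k : Fin K₁, Fin (calPart D k).size) =>
    groupScores (fit (trainPart D)) (calPart D p.1) p.2

theorem sum_orderStat_eq_sum_min {M : Type*} [AddCommMonoid M] {n : ℕ} (v : Fin n → ℝ)
    (g : ℝ → M) :
    ∑ i : Fin n, (n - (i.val + 1)) • g (orderStat v i) =
      ∑ p : Fin n × Fin n with p.1 < p.2, g (min (v p.1) (v p.2)) := by
  set σ := Tuple.sort v with hσ
  have hmono : Monotone (v ∘ σ) := Tuple.monotone_sort v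
  have h1 : ∑ i : Fin n, (n - (i.val + 1)) • g (orderStat v i) =
      ∑ p : Fin n × Fin n with p.1 < p.2, g (min (v (σ p.1)) (v (σ p.2))) := by
    rw [Finset.sum_filter, Fintype.sum_prod_type]
    refine Finset.sum_congr rfl fun i _ => ?_
    rw [← Finset.sum_filter]
    rw [Finset.sum_congr rfl (g := fun _ => g (orderStat v i))]
    · rw [Finset.sum_const]
      congr 1
      have : (Finset.univ.filter fun j : Fin n => i < j) = Finset.Ioi i := by ext; simp
      rw [this, Fin.card_Ioi]
      omega
    · intro j hj
      simp only [Finset.mem_filter, Finset.mem_univ, true_and] at hj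
      exact congrArg g (min_eq_left (hmono hj.le))
  rw [h1]
  refine Finset.sum_bij'
    (fun p _ => if σ p.1 < σ p.2 then (σ p.1, σ p.2) else (σ p.2, σ p.1))
    (fun q _ => if σ.symm q.1 < σ.symm q.2 then (σ.symm q.1, σ.symm q.2)
      else (σ.symm q.2, σ.symm q.1)) ?_ ?_ ?_ ?_ ?_
  · rintro ⟨a, b⟩ h
    simp only [Finset.mem_filter, Finset.mem_univ, true_and] at h ⊢
    have : σ a ≠ σ b := σ.injective.ne h.ne
    split_ifs <;> grind
  · rintro ⟨a, b⟩ h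
    simp only [Finset.mem_filter, Finset.mem_univ, true_and] at h ⊢
    have : σ.symm a ≠ σ.symm b := σ.symm.injective.ne h.ne
    split_ifs <;> grind
  · rintro ⟨a, b⟩ h
    simp only [Finset.mem_filter, Finset.mem_univ, true_and] at h
    split_ifs <;> simp_all [not_lt.2 h.le]
  · rintro ⟨a, b⟩ h
    simp only [Finset.mem_filter, Finset.mem_univ, true_and] at h
    split_ifs <;> simp_all [not_lt.2 h.le]
  · rintro ⟨a, b⟩ h
    split_ifs
    · rfl
    · rw [min_comm]

/-- The distribution `calMeasure` is the one that puts mass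
`1 / ((K₁^{≥2} + 1) (N_k choose 2))` on each within-group pairwise minimum
`min {s(Z_{k,i}), s(Z_{k,i'})}`, `i < i'`, and mass `1 / (K₁^{≥2} + 1)` on `+∞`. -/
theorem calMeasure_eq_pairwise_min (s : 𝒳 × 𝒴 → ℝ) (cal : Fin K₁ → GroupData 𝒳 𝒴) :
    calMeasure s cal =
      (∑ k : Fin K₁ with 2 ≤ (cal k).size,
        ∑ p : Fin (cal k).size × Fin (cal k).size with p.1 < p.2,
          (1 / (((numTwo cal : ℝ≥0∞) + 1) * ((cal k).size.choose 2 : ℝ≥0∞))) •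
            Measure.dirac ((min (s ((cal k).point p.1)) (s ((cal k).point p.2)) : ℝ) : EReal))
      + (1 / ((numTwo cal : ℝ≥0∞) + 1)) • Measure.dirac (⊤ : EReal) := by
  unfold calMeasure
  congr 1
  refine Finset.sum_congr rfl fun k _ => ?_
  have h := sum_orderStat_eq_sum_min (groupScores s (cal k)) (fun t : ℝ =>
    (1 / (((numTwo cal : ℝ≥0∞) + 1) * ((cal k).size.choose 2 : ℝ≥0∞))) •
      Measure.dirac (t : EReal))
  unfold groupScores at h
  rw [← h]
  refine Finset.sum_congr rfl fun i _ => ?_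
  rw [← Nat.cast_smul_eq_nsmul ℝ≥0∞, smul_smul, mul_one_div]
  rfl

end Method

end HCP

end

/-! Two independent responses at the same feature x both escape Ĉ(x) with probability α_D(x)², and
both escape exactly when the minimum of their scores exceeds T. So the second moment of the
miscoverage is a first moment for pairwise minima. Averaging over all pairs of a group gives
`pairMeasure`, of mass 1, or 0 below two points, and makes whole groups the exchangeable units.

Multiplying by p_{≥2} undoes the conditioning: p_{≥2} E[α_D²] is the expected mass that a fresh
group puts above T (`lintegral_groupLaw_pairMeasure_Ioi`). Any of K₁ + 1 i.i.d. groups can be the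
fresh one, so (K₁ + 1) p_{≥2} E[α_D²] is the mean of Σ_j F_j((T_j, ∞]), where F_j is the measure of
group j and T_j the threshold computed from the others (`sum_lintegral_leaveOneOut`).

This sum is bounded pointwise. Let P = Σ_j F_j, let m be its mass, with mean (K₁ + 1) p_{≥2}, and β
= 1 - α². If F_j ≠ 0, then T_j is the quantile at level mβ of P with the mass of F_j moved to +∞.
The move can only raise the quantile, so the sum is at most the mass of P above its own mβ-quantile,
hence at most mα². Conversely the move lowers the distribution function by at most 1, so T_j is at
most the (mβ + 1)-quantile of P; without ties across groups an atom of P has mass at most 1, and the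
sum is at least mα² - 2. Taking means and dividing gives both bounds. The training groups, hence the
score, are fixed meanwhile and integrated last. -/

noncomputable section

namespace HCP

/-! ### Quantiles of finite measures on the extended reals -/

section Quantile

open Filter Topology

/-- Right-continuity of the distribution function; `hc` puts ⊤ in the set whose infimum is taken. -/
theorem le_real_Iic_quantile {c : ℝ} (P : Measure EReal) [IsFiniteMeasure P]
    (hc : c ≤ P.real Set.univ) : c ≤ P.real (Set.Iic (quantile c P)) := by
  have hne : {t : EReal | c ≤ P.real (Set.Iic t)}.Nonempty := ⟨⊤, by simpa using hc⟩
  obtain ⟨u, hu_anti, hu_tendsto, hu_mem⟩ := exists_seq_tendsto_sInf hne (OrderBot.bddBelow _)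
  have hset : Set.Iic (quantile c P) = ⋂ n, Set.Iic (u n) := by
    ext t
    simp only [Set.mem_Iic, Set.mem_iInter]
    exact ⟨fun h n => h.trans (sInf_le (hu_mem n)), fun h => ge_of_tendsto' hu_tendsto h⟩
  have hlim : Tendsto (fun n => P.real (Set.Iic (u n))) atTop
      (𝓝 (P.real (Set.Iic (quantile c P)))) := by
    rw [hset]
    refine (ENNReal.tendsto_toReal (measure_ne_top _ _)).comp
      (tendsto_measure_iInter_atTop (fun n => measurableSet_Iic.nullMeasurableSet) ?_
        ⟨0, measure_ne_top _ _⟩)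
    exact fun m n hmn => Set.Iic_subset_Iic.2 (hu_anti hmn)
  exact ge_of_tendsto' hlim hu_mem

theorem quantile_le_iff {c : ℝ} (P : Measure EReal) [IsFiniteMeasure P]
    (hc : c ≤ P.real Set.univ) (t : EReal) :
    quantile c P ≤ t ↔ c ≤ P.real (Set.Iic t) :=
  ⟨fun h => (le_real_Iic_quantile P hc).trans (measureReal_mono (Set.Iic_subset_Iic.2 h)),
    fun h => sInf_le h⟩

/-- Every point below the quantile has distribution function less than `c`; pass to the left limit.
-/
theorem real_Iio_quantile_le {c : ℝ} (hc : 0 ≤ c) (P : Measure EReal) [IsFiniteMeasure P] :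
    P.real (Set.Iio (quantile c P)) ≤ c := by
  rcases eq_or_ne (quantile c P) ⊥ with h | h
  · simpa [h] using hc
  obtain ⟨u, hu_mono, hu_lt, hu_tendsto⟩ :=
    exists_seq_strictMono_tendsto' (bot_lt_iff_ne_bot.2 h)
  have hset := iUnion_Iic_eq_Iio_of_lt_of_tendsto (fun n => (hu_lt n).2) hu_tendsto
  have hlim : Tendsto (fun n => P.real (Set.Iic (u n))) atTop
      (𝓝 (P.real (Set.Iio (quantile c P)))) := by
    rw [← hset]
    refine (ENNReal.tendsto_toReal (measure_ne_top _ _)).comp (tendsto_measure_iUnion_atTop ?_)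
    exact fun m n hmn => Set.Iic_subset_Iic.2 (hu_mono.monotone hmn)
  refine le_of_tendsto' hlim fun n => le_of_lt (not_le.1 fun hn => ?_)
  exact ((hu_lt n).2.trans_le (sInf_le hn)).false

theorem quantile_inv_smul {c r : ℝ} (hr : 0 < r) (P : Measure EReal) :
    quantile c ((ENNReal.ofReal r)⁻¹ • P) = quantile (r * c) P := by
  unfold quantile
  congr 1
  ext t
  simp only [Set.mem_ofPred_eq, measureReal_ennreal_smul_apply, ENNReal.toReal_inv,
    ENNReal.toReal_ofReal hr.le]
  rw [← div_eq_inv_mul, le_div_iff₀ hr, mul_comm]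

theorem quantile_anti {c c' : ℝ} {P Q : Measure EReal}
    (h : ∀ t, c ≤ P.real (Set.Iic t) → c' ≤ Q.real (Set.Iic t)) :
    quantile c' Q ≤ quantile c P :=
  sInf_le_sInf fun t ht => h t ht

end Quantile

/-! ### Deterministic leave-one-out bounds -/

section LeaveOneOut

variable {ι : Type*} [Fintype ι]

/-- The mass that each of finitely many distributions `F j` puts above the quantile computed from
the others, with the mass of `F j` moved to `⊤`, sums to at most the total mass times `1 - β`. -/
theorem sum_real_Ioi_quantile_le (F R : ι → Measure EReal) [∀ j, IsFiniteMeasure (F j)]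
    [∀ j, IsFiniteMeasure (R j)] (hF : ∀ j, F j = 0 ∨ IsProbabilityMeasure (F j))
    (hR : ∀ j, F j + R j = ∑ i, F i) {β : ℝ} (hβ : β ≤ 1) :
    ∑ j, (F j).real (Set.Ioi
        (quantile ((∑ i, F i).real Set.univ * β) (R j + Measure.dirac ⊤))) ≤
      (∑ i, F i).real Set.univ * (1 - β) := by
  set P := ∑ i, F i with hP
  have hsum : ∀ S, P.real S = ∑ j, (F j).real S := fun S => by
    simp only [hP, measureReal_def, Measure.finsetSum_apply]
    exact ENNReal.toReal_sum fun j _ => measure_ne_top _ _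
  have hPfin : IsFiniteMeasure P := by rw [hP]; infer_instance
  set c := P.real Set.univ * β
  have hc : c ≤ P.real Set.univ := mul_le_of_le_one_right measureReal_nonneg hβ
  have key : ∀ j, (F j).real (Set.Ioi (quantile c (R j + Measure.dirac ⊤))) ≤
      (F j).real (Set.Ioi (quantile c P)) := by
    intro j
    rcases hF j with h | h
    · simp [h]
    refine measureReal_mono (Set.Ioi_subset_Ioi (quantile_anti fun t ht => ?_))
    -- The Dirac mass is seen only at ⊤, where `hc` suffices; at any other `t`, restoring `F j` can
    -- only add mass.
    rcases eq_or_ne t ⊤ with rfl | htop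
    · simpa using hc
    · rw [← hR j, measureReal_add_apply]
      rw [measureReal_add_apply, measureReal_def (Measure.dirac _),
        Measure.dirac_apply' _ measurableSet_Iic] at ht
      simp [htop] at ht
      linarith [measureReal_nonneg (μ := F j) (s := Set.Iic t)]
  refine (Finset.sum_le_sum fun j _ => key j).trans ?_
  rw [← hsum, ← Set.compl_Iic, measureReal_compl measurableSet_Iic]
  have := le_real_Iic_quantile P hc
  change _ ≤ P.real Set.univ * (1 - β)
  rw [mul_sub, mul_one]
  linarith

/-- The loss of 2 is 1 for removing `F j`, which shifts the level from `c` to `c + 1`, plus 1 for a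
possible atom of the sum at its quantile. -/
theorem le_sum_real_Ioi_quantile (F R : ι → Measure EReal) [∀ j, IsFiniteMeasure (F j)]
    [∀ j, IsFiniteMeasure (R j)] (hF : ∀ j, F j = 0 ∨ IsProbabilityMeasure (F j))
    (hR : ∀ j, F j + R j = ∑ i, F i) {β : ℝ} (hβ : 0 ≤ β)
    (hatom : ∀ t i j, i ≠ j → F i {t} = 0 ∨ F j {t} = 0) :
    (∑ i, F i).real Set.univ * (1 - β) - 2 ≤ ∑ j, (F j).real (Set.Ioi
        (quantile ((∑ i, F i).real Set.univ * β) (R j + Measure.dirac ⊤))) := by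
  set P := ∑ i, F i with hP
  have hsum : ∀ S, P.real S = ∑ j, (F j).real S := fun S => by
    simp only [hP, measureReal_def, Measure.finsetSum_apply]
    exact ENNReal.toReal_sum fun j _ => measure_ne_top _ _
  have hPfin : IsFiniteMeasure P := by rw [hP]; infer_instance
  set c := P.real Set.univ * β
  have hc : 0 ≤ c := mul_nonneg measureReal_nonneg hβ
  have hF1 : ∀ j S, (F j).real S ≤ 1 := by
    intro j S
    rcases hF j with h | h
    · simp [h]
    · exact measureReal_le_one
  have key : ∀ j, (F j).real (Set.Ioi (quantile (c + 1) P)) ≤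
      (F j).real (Set.Ioi (quantile c (R j + Measure.dirac ⊤))) := by
    intro j
    refine measureReal_mono (Set.Ioi_subset_Ioi (quantile_anti fun t ht => ?_))
    rw [← hR j, measureReal_add_apply] at ht
    rw [measureReal_add_apply]
    linarith [hF1 j (Set.Iic t), measureReal_nonneg (μ := Measure.dirac (⊤ : EReal))
      (s := Set.Iic t)]
  refine le_trans ?_ (Finset.sum_le_sum fun j _ => key j)
  -- By `hatom` at most one `F j` charges this point.
  have hsingle : P.real {quantile (c + 1) P} ≤ 1 := by
    rw [hsum]
    by_cases h : ∃ j, F j {quantile (c + 1) P} ≠ 0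
    · obtain ⟨j, hj⟩ := h
      rw [Finset.sum_eq_single j]
      · exact hF1 j _
      · intro i _ hij
        simp [measureReal_def, (hatom _ i j hij).resolve_right hj]
      · simp
    · push Not at h
      simp [measureReal_def, h]
  have hIio := real_Iio_quantile_le (c := c + 1) (by linarith) P
  have hIic : P.real (Set.Iic (quantile (c + 1) P)) ≤
      P.real (Set.Iio (quantile (c + 1) P)) + P.real {quantile (c + 1) P} := by
    rw [← Set.Iio_union_right]
    exact measureReal_union_le _ _
  rw [← hsum, ← Set.compl_Iic, measureReal_compl measurableSet_Iic]
  change P.real Set.univ * (1 - β) - 2 ≤ _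
  rw [mul_sub, mul_one]
  linarith

end LeaveOneOut

/-! ### Pairwise minima within groups -/

section PairMeasure

variable {𝒳 𝒴 : Type*} {K₁ : ℕ}

/-- The uniform distribution on the pairwise minima `min {s(Zᵢ), s(Zᵢ')}`, `i < i'`, of the scores
of one group; it vanishes when the group has fewer than two points. -/
def pairMeasure (s : 𝒳 × 𝒴 → ℝ) (z : GroupData 𝒳 𝒴) : Measure EReal :=
  ∑ p : Fin z.size × Fin z.size with p.1 < p.2, ((z.size.choose 2 : ℝ≥0∞)⁻¹) •
    Measure.dirac ((min (s (z.point p.1)) (s (z.point p.2)) : ℝ) : EReal)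

theorem card_filter_lt (n : ℕ) :
    (Finset.univ.filter fun p : Fin n × Fin n => p.1 < p.2).card = n.choose 2 := by
  -- With constant scores and summand 1, the order-statistic identity counts the pairs.
  have h := sum_orderStat_eq_sum_min (M := ℕ) (fun _ : Fin n => (0 : ℝ)) (fun _ => 1)
  rw [Finset.card_eq_sum_ones, ← h]
  simp only [smul_eq_mul, mul_one]
  rw [Fin.sum_univ_eq_sum_range (fun i => n - (i + 1)) n, Nat.choose_two_right,
    ← Finset.sum_range_id, ← Finset.sum_range_reflect]
  exact Finset.sum_congr rfl fun i hi => by have := Finset.mem_range.1 hi; omega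

theorem pairMeasure_of_size_lt (s : 𝒳 × 𝒴 → ℝ) {z : GroupData 𝒳 𝒴} (hz : ¬ 2 ≤ z.size) :
    pairMeasure s z = 0 := by
  refine Finset.sum_eq_zero fun p hp => ?_
  have h1 := p.1.isLt
  have h2 := p.2.isLt
  have h3 : p.1 < p.2 := by simpa using hp
  rw [Fin.lt_def] at h3
  omega

theorem pairMeasure_univ (s : 𝒳 × 𝒴 → ℝ) {z : GroupData 𝒳 𝒴} (hz : 2 ≤ z.size) :
    pairMeasure s z Set.univ = 1 := by
  have h0 : (z.size.choose 2 : ℝ≥0∞) ≠ 0 := by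
    exact_mod_cast (Nat.choose_pos hz).ne'
  simp [pairMeasure, Measure.finsetSum_apply, card_filter_lt,
    ENNReal.mul_inv_cancel h0 (ENNReal.natCast_ne_top _)]

theorem isProbabilityMeasure_pairMeasure (s : 𝒳 × 𝒴 → ℝ) {z : GroupData 𝒳 𝒴}
    (hz : 2 ≤ z.size) : IsProbabilityMeasure (pairMeasure s z) :=
  ⟨pairMeasure_univ s hz⟩

theorem pairMeasure_eq_zero_or_isProbabilityMeasure (s : 𝒳 × 𝒴 → ℝ) (z : GroupData 𝒳 𝒴) :
    pairMeasure s z = 0 ∨ IsProbabilityMeasure (pairMeasure s z) := by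
  by_cases hz : 2 ≤ z.size
  · exact .inr (isProbabilityMeasure_pairMeasure s hz)
  · exact .inl (pairMeasure_of_size_lt s hz)

instance (s : 𝒳 × 𝒴 → ℝ) (z : GroupData 𝒳 𝒴) : IsFiniteMeasure (pairMeasure s z) := by
  rcases pairMeasure_eq_zero_or_isProbabilityMeasure s z with h | h
  · rw [h]; infer_instance
  · infer_instance

theorem sum_pairMeasure_univ (s : 𝒳 × 𝒴 → ℝ) (w : Fin K₁ → GroupData 𝒳 𝒴) :
    (∑ k, pairMeasure s (w k)) Set.univ = numTwo w := by
  rw [Measure.finsetSum_apply, numTwo, Finset.card_filter, Nat.cast_sum]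
  refine Finset.sum_congr rfl fun k _ => ?_
  split_ifs with h
  · simp [pairMeasure_univ s h]
  · simp [pairMeasure_of_size_lt s h]

theorem calMeasure_eq_smul_sum_pairMeasure (s : 𝒳 × 𝒴 → ℝ) (cal : Fin K₁ → GroupData 𝒳 𝒴) :
    calMeasure s cal =
      ((numTwo cal : ℝ≥0∞) + 1)⁻¹ • (∑ k, pairMeasure s (cal k) + Measure.dirac ⊤) := by
  rw [calMeasure_eq_pairwise_min, smul_add, one_div]
  congr 1
  rw [Finset.sum_filter, Finset.smul_sum]
  refine Finset.sum_congr rfl fun k _ => ?_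
  split_ifs with h
  · rw [pairMeasure, Finset.smul_sum]
    refine Finset.sum_congr rfl fun p _ => ?_
    rw [smul_smul, one_div, ENNReal.mul_inv (.inl (by simp)) (.inl (by simp))]
  · rw [pairMeasure_of_size_lt s h, smul_zero]

theorem calMeasure_univ (s : 𝒳 × 𝒴 → ℝ) (cal : Fin K₁ → GroupData 𝒳 𝒴) :
    calMeasure s cal Set.univ = 1 := by
  rw [calMeasure_eq_smul_sum_pairMeasure, Measure.smul_apply, Measure.add_apply,
    sum_pairMeasure_univ, measure_univ, smul_eq_mul]
  exact ENNReal.inv_mul_cancel (by simp) (by simp)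

instance (s : 𝒳 × 𝒴 → ℝ) (cal : Fin K₁ → GroupData 𝒳 𝒴) :
    IsProbabilityMeasure (calMeasure s cal) :=
  ⟨calMeasure_univ s cal⟩

/-- Clearing the normalisation moves the random group count into the level, where it can be compared
across left-out groups. -/
theorem quantile_calMeasure (β : ℝ) (s : 𝒳 × 𝒴 → ℝ) (cal : Fin K₁ → GroupData 𝒳 𝒴) :
    quantile β (calMeasure s cal) =
      quantile ((numTwo cal + 1) * β) (∑ k, pairMeasure s (cal k) + Measure.dirac ⊤) := by
  have : ((numTwo cal : ℝ≥0∞) + 1) = ENNReal.ofReal ((numTwo cal : ℝ) + 1) := by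
    rw [ENNReal.ofReal_add (by positivity) zero_le_one]
    simp
  rw [calMeasure_eq_smul_sum_pairMeasure, this, quantile_inv_smul (by positivity)]

theorem numTwo_succAbove (w : Fin (K₁ + 1) → GroupData 𝒳 𝒴) (j : Fin (K₁ + 1))
    (hj : 2 ≤ (w j).size) : numTwo w = numTwo (fun i => w (j.succAbove i)) + 1 := by
  simp only [numTwo, Finset.card_filter]
  rw [Fin.sum_univ_succAbove _ j, if_pos hj, add_comm]

/-- The mass that the pairwise minima of a group put above the threshold computed from the others. -/
theorem pairMeasure_Ioi_quantile_calMeasure (s : 𝒳 × 𝒴 → ℝ) (w : Fin (K₁ + 1) → GroupData 𝒳 𝒴) (β : ℝ)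
    (j : Fin (K₁ + 1)) :
    (pairMeasure s (w j)).real
        (Set.Ioi (quantile β (calMeasure s fun i => w (j.succAbove i)))) =
      (pairMeasure s (w j)).real (Set.Ioi (quantile
        ((∑ i, pairMeasure s (w i)).real Set.univ * β)
        (∑ i, pairMeasure s (w (j.succAbove i)) + Measure.dirac ⊤))) := by
  -- If group `j` counts, the others' count plus one is the full count, so the level does not depend
  -- on `j`; if not, both sides vanish.
  by_cases hj : 2 ≤ (w j).size
  · rw [quantile_calMeasure, measureReal_def (∑ i, pairMeasure s (w i)), sum_pairMeasure_univ,
      numTwo_succAbove w j hj, ENNReal.toReal_natCast, Nat.cast_succ]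
  · simp [pairMeasure_of_size_lt s hj]

theorem sum_pairMeasure_Ioi_le (s : 𝒳 × 𝒴 → ℝ) (w : Fin (K₁ + 1) → GroupData 𝒳 𝒴) {β : ℝ}
    (hβ : β ≤ 1) :
    ∑ j, (pairMeasure s (w j)).real
        (Set.Ioi (quantile β (calMeasure s fun i => w (j.succAbove i)))) ≤
      numTwo w * (1 - β) := by
  simp only [pairMeasure_Ioi_quantile_calMeasure]
  refine (sum_real_Ioi_quantile_le (fun j => pairMeasure s (w j))
    (fun j => ∑ i, pairMeasure s (w (j.succAbove i)))
    (fun j => pairMeasure_eq_zero_or_isProbabilityMeasure s (w j))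
    (fun j => (Fin.sum_univ_succAbove (fun i => pairMeasure s (w i)) j).symm) hβ).trans_eq ?_
  rw [measureReal_def, sum_pairMeasure_univ]
  simp

theorem pairMeasure_singleton_eq_zero (s : 𝒳 × 𝒴 → ℝ) (z : GroupData 𝒳 𝒴) (t : EReal)
    (h : ∀ i, (groupScores s z i : EReal) ≠ t) : pairMeasure s z {t} = 0 := by
  rw [pairMeasure, Measure.finsetSum_apply]
  refine Finset.sum_eq_zero fun p _ => ?_
  rw [Measure.smul_apply, Measure.dirac_apply' _ (measurableSet_singleton _),
    Set.indicator_of_notMem, smul_zero]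
  rcases min_choice (s (z.point p.1)) (s (z.point p.2)) with h' | h' <;> rw [h']
  · exact h p.1
  · exact h p.2

/-- Ties inside one group are harmless, since that group has mass at most 1 anyway. -/
theorem le_sum_pairMeasure_Ioi (s : 𝒳 × 𝒴 → ℝ) (w : Fin (K₁ + 1) → GroupData 𝒳 𝒴) {β : ℝ}
    (hβ : 0 ≤ β)
    (hdist : ∀ i j, i ≠ j → ∀ a b, groupScores s (w i) a ≠ groupScores s (w j) b) :
    numTwo w * (1 - β) - 2 ≤ ∑ j, (pairMeasure s (w j)).real
        (Set.Ioi (quantile β (calMeasure s fun i => w (j.succAbove i)))) := by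
  simp only [pairMeasure_Ioi_quantile_calMeasure]
  refine Eq.trans_le ?_ (le_sum_real_Ioi_quantile (fun j => pairMeasure s (w j))
    (fun j => ∑ i, pairMeasure s (w (j.succAbove i)))
    (fun j => pairMeasure_eq_zero_or_isProbabilityMeasure s (w j))
    (fun j => (Fin.sum_univ_succAbove (fun i => pairMeasure s (w i)) j).symm) hβ ?_)
  · rw [measureReal_def, sum_pairMeasure_univ]
    simp
  · intro t i j hij
    by_contra! hne
    obtain ⟨a, ha⟩ := not_forall_not.1 fun h => hne.1 (pairMeasure_singleton_eq_zero s _ t h)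
    obtain ⟨b, hb⟩ := not_forall_not.1 fun h => hne.2 (pairMeasure_singleton_eq_zero s _ t h)
    exact hdist i j hij a b (EReal.coe_eq_coe_iff.1 (ha.trans hb.symm))

end PairMeasure

/-! ### Measurability, one group size at a time -/

theorem pairMeasure_mk_apply {𝒳 𝒴 : Type*} (s : 𝒳 × 𝒴 → ℝ) (x : 𝒳) (n : ℕ) (y : Fin n → 𝒴)
    (S : Set EReal) :
    pairMeasure s (x, ⟨n, y⟩) S =
      ∑ p : Fin n × Fin n with p.1 < p.2, ((n.choose 2 : ℝ≥0∞)⁻¹) *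
        Measure.dirac ((min (s (x, y p.1)) (s (x, y p.2)) : ℝ) : EReal) S := by
  rw [pairMeasure, Measure.finsetSum_apply]
  rfl

section Measurability

variable {𝒳 𝒴 A C : Type*} [MeasurableSpace 𝒳] [MeasurableSpace 𝒴] [MeasurableSpace A]
  [MeasurableSpace C]

/-- A set in the disjoint union is measurable when all its slices are; the image of `S` has slices
`S` and ∅. -/
theorem measurableEmbedding_sigma_mk (n : ℕ) :
    MeasurableEmbedding (fun y : Fin n → 𝒴 => (⟨n, y⟩ : Σ n : ℕ, (Fin n → 𝒴))) where
  injective := sigma_mk_injective (β := fun n => Fin n → 𝒴)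
  measurable := measurable_sigma_mk n
  measurableSet_image' := by
    intro S hS
    refine MeasurableSpace.measurableSet_iInf.2 fun m => ?_
    change MeasurableSet ((fun y : Fin m → 𝒴 => (⟨m, y⟩ : Σ n : ℕ, (Fin n → 𝒴))) ⁻¹' _)
    by_cases h : m = n
    · subst h
      rwa [Set.preimage_image_eq _ (sigma_mk_injective (β := fun n => Fin n → 𝒴))]
    · convert MeasurableSet.empty
      ext y
      simp only [Set.mem_preimage, Set.mem_image, Set.mem_empty_iff_false, iff_false]
      rintro ⟨y', -, h'⟩
      exact h (congrArg Sigma.fst h').symm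

/-- Measurability on a space of groups may be checked for each group size separately. -/
theorem measurable_of_forall_size {f : A × GroupData 𝒳 𝒴 → C}
    (hf : ∀ n, Measurable fun q : A × 𝒳 × (Fin n → 𝒴) => f (q.1, q.2.1, ⟨n, q.2.2⟩)) :
    Measurable f := by
  intro S hS
  have he : ∀ n, MeasurableEmbedding fun q : A × 𝒳 × (Fin n → 𝒴) =>
      ((q.1, q.2.1, ⟨n, q.2.2⟩) : A × GroupData 𝒳 𝒴) := fun n =>
    MeasurableEmbedding.id.prodMap (MeasurableEmbedding.id.prodMap
      (measurableEmbedding_sigma_mk (𝒴 := 𝒴) n))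
  have : f ⁻¹' S = ⋃ n, (fun q : A × 𝒳 × (Fin n → 𝒴) =>
      ((q.1, q.2.1, ⟨n, q.2.2⟩) : A × GroupData 𝒳 𝒴)) ''
        ((fun q : A × 𝒳 × (Fin n → 𝒴) => f (q.1, q.2.1, ⟨n, q.2.2⟩)) ⁻¹' S) := by
    ext ⟨a, x, n, y⟩
    simp only [Set.mem_preimage, Set.mem_iUnion, Set.mem_image]
    constructor
    · exact fun h => ⟨n, (a, x, y), h, rfl⟩
    · rintro ⟨m, q, hq, heq⟩
      rwa [heq] at hq
  rw [this]
  exact .iUnion fun n => (he n).measurableSet_image.2 (hf n hS)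

theorem measurable_size : Measurable (GroupData.size : GroupData 𝒳 𝒴 → ℕ) := by
  have : Measurable fun q : Unit × GroupData 𝒳 𝒴 => q.2.size :=
    measurable_of_forall_size fun n => measurable_const
  exact this.comp (measurable_prodMk_left (x := ()))

variable {s : A → 𝒳 × 𝒴 → ℝ}

/-- The parameter in `A` may drive both the score and the set, which covers a fitted score as well
as a random threshold. -/
theorem measurable_pairMeasure (hs : Measurable (Function.uncurry s)) {S : Set (A × EReal)}
    (hS : MeasurableSet S) :
    Measurable fun q : A × GroupData 𝒳 𝒴 => pairMeasure (s q.1) q.2 {t | (q.1, t) ∈ S} := by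
  refine measurable_of_forall_size fun n => ?_
  simp only [pairMeasure_mk_apply]
  refine Finset.measurable_sum _ fun p _ => ?_
  refine Measurable.const_mul ?_ _
  have hpt : ∀ i : Fin n, Measurable fun q : A × 𝒳 × (Fin n → 𝒴) => s q.1 (q.2.1, q.2.2 i) :=
    fun i => hs.comp (f := fun q : A × 𝒳 × (Fin n → 𝒴) => (q.1, q.2.1, q.2.2 i)) (by fun_prop)
  have hmin : Measurable fun q : A × 𝒳 × (Fin n → 𝒴) =>
      (q.1, ((min (s q.1 (q.2.1, q.2.2 p.1)) (s q.1 (q.2.1, q.2.2 p.2)) : ℝ) : EReal)) :=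
    measurable_fst.prodMk (measurable_coe_real_ereal.comp ((hpt _).min (hpt _)))
  have hind : Measurable (S.indicator (1 : A × EReal → ℝ≥0∞)) := measurable_one.indicator hS
  convert hind.comp hmin using 2 with q
  have hq : MeasurableSet {t | (q.1, t) ∈ S} := hS.preimage measurable_prodMk_left
  rw [Measure.dirac_apply' _ hq]
  rfl

theorem measurable_numTwo {K : ℕ} :
    Measurable (numTwo : (Fin K → GroupData 𝒳 𝒴) → ℕ) := by
  unfold numTwo
  simp only [Finset.card_filter]
  refine Finset.measurable_sum _ fun k _ => Measurable.ite ?_ measurable_const measurable_const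
  exact (measurable_size.comp (measurable_pi_apply k)) (measurableSet_Ici (a := 2))

theorem measurable_quantile_calMeasure (hs : Measurable (Function.uncurry s)) {K : ℕ} {β : ℝ}
    (hβ : β ≤ 1) :
    Measurable fun q : A × (Fin K → GroupData 𝒳 𝒴) => quantile β (calMeasure (s q.1) q.2) := by
  refine measurable_of_Iic fun t => ?_
  simp only [Set.preimage, Set.mem_Iic]
  -- Sublevel sets of the quantile become superlevel sets of a distribution function, a finite sum
  -- of measurable terms.
  have : ∀ q : A × (Fin K → GroupData 𝒳 𝒴), quantile β (calMeasure (s q.1) q.2) ≤ t ↔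
      β ≤ (calMeasure (s q.1) q.2).real (Set.Iic t) :=
    fun q => quantile_le_iff _ (by simpa using hβ) t
  simp only [this, measureReal_def]
  refine measurableSet_le measurable_const (Measurable.ennreal_toReal ?_)
  simp only [calMeasure_eq_smul_sum_pairMeasure, Measure.smul_apply, Measure.add_apply,
    Measure.finsetSum_apply, smul_eq_mul]
  refine Measurable.mul ?_ (Measurable.add_const (Finset.measurable_sum _ fun k _ => ?_) _)
  · have : Measurable fun n : ℕ => ((n : ℝ≥0∞) + 1)⁻¹ := .of_discrete
    exact this.comp (measurable_numTwo.comp measurable_snd)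
  · have h := measurable_pairMeasure hs (S := Set.univ ×ˢ Set.Iic t)
      (MeasurableSet.univ.prod measurableSet_Iic)
    have h' : Measurable fun q : A × (Fin K → GroupData 𝒳 𝒴) => (q.1, q.2 k) := by fun_prop
    convert h.comp h' using 2 with q
    simp [Set.Iic]

theorem measurableSet_groupScores_ne (hs : Measurable (Function.uncurry s)) :
    MeasurableSet {q : (A × GroupData 𝒳 𝒴) × GroupData 𝒳 𝒴 |
      ∀ a b, groupScores (s q.1.1) q.1.2 a ≠ groupScores (s q.1.1) q.2 b} := by
  refine measurableSet_setOfPred.2 (measurable_of_forall_size fun n => ?_)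
  have h : Measurable fun q : (A × 𝒳 × (Fin n → 𝒴)) × GroupData 𝒳 𝒴 =>
      ∀ a b, groupScores (s q.1.1) q.2 a ≠ s q.1.1 (q.1.2.1, q.1.2.2 b) := by
    refine measurable_of_forall_size fun m => ?_
    change Measurable fun q : (A × 𝒳 × (Fin n → 𝒴)) × 𝒳 × (Fin m → 𝒴) => ∀ (a : Fin m) (b : Fin n),
      ¬ s q.1.1 (q.2.1, q.2.2 a) = s q.1.1 (q.1.2.1, q.1.2.2 b)
    refine .forall fun a => .forall fun b => .not ?_
    exact measurableSet_setOfPred.1 (measurableSet_eq_fun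
      (hs.comp (f := fun q : (A × 𝒳 × (Fin n → 𝒴)) × 𝒳 × (Fin m → 𝒴) =>
        (q.1.1, q.2.1, q.2.2 a)) (by fun_prop))
      (hs.comp (f := fun q : (A × 𝒳 × (Fin n → 𝒴)) × 𝒳 × (Fin m → 𝒴) =>
        (q.1.1, q.1.2.1, q.1.2.2 b)) (by fun_prop)))
  exact h.comp (f := fun q : (A × GroupData 𝒳 𝒴) × 𝒳 × (Fin n → 𝒴) =>
    ((q.1.1, q.2.1, q.2.2), q.1.2)) (by fun_prop)

end Measurability

/-! ### Integrals over one group -/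

instance {𝒳 𝒴 : Type*} [MeasurableSpace 𝒳] [MeasurableSpace 𝒴] (PY : Kernel 𝒳 𝒴)
    [IsMarkovKernel PY] : IsMarkovKernel (responses PY) :=
  ⟨fun p => Measure.isProbabilityMeasure_map (measurable_sigma_mk p.2).aemeasurable⟩

theorem lintegral_groupLaw {𝒳 𝒴 : Type*} [MeasurableSpace 𝒳] [MeasurableSpace 𝒴]
    (PX : Measure 𝒳) (PN : Kernel 𝒳 ℕ) (PY : Kernel 𝒳 𝒴) [IsMarkovKernel PY]
    {f : GroupData 𝒳 𝒴 → ℝ≥0∞} (hf : Measurable f) :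
    ∫⁻ z, f z ∂groupLaw PX PN PY =
      ∫⁻ p, ∫⁻ y, f (p.1, ⟨p.2, y⟩) ∂Measure.pi (fun _ : Fin p.2 => PY p.1) ∂(PX ⊗ₘ PN) := by
  have h : Measurable fun p : (𝒳 × ℕ) × (Σ n : ℕ, (Fin n → 𝒴)) => (p.1.1, p.2) := by fun_prop
  rw [groupLaw, lintegral_map hf h, Measure.lintegral_compProd (f := fun p : (𝒳 × ℕ) × (Σ n : ℕ, (Fin n → 𝒴)) => f (p.1.1, p.2)) (hf.comp h)]
  refine lintegral_congr fun p => ?_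
  change ∫⁻ b, f (p.1, b) ∂((Measure.pi (fun _ : Fin p.2 => PY p.1)).map _) = _
  rw [lintegral_map (by fun_prop) (measurable_sigma_mk p.2)]

section Integrals

variable {𝒳 𝒴 : Type*} [MeasurableSpace 𝒳] [MeasurableSpace 𝒴]
  (PX : Measure 𝒳) [IsProbabilityMeasure PX] (PN : Kernel 𝒳 ℕ) [IsMarkovKernel PN]
  (PY : Kernel 𝒳 𝒴) [IsMarkovKernel PY]

instance : IsProbabilityMeasure (groupLaw PX PN PY) :=
  Measure.isProbabilityMeasure_map (by fun_prop)

theorem pi_const_apply_pair {ι Y : Type*} [Fintype ι] [MeasurableSpace Y] (P : Measure Y)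
    [IsProbabilityMeasure P] {i j : ι} (hij : i ≠ j) (S : Set Y) :
    Measure.pi (fun _ : ι => P) {y | y i ∈ S ∧ y j ∈ S} = P S ^ 2 := by
  classical
  have : {y : ι → Y | y i ∈ S ∧ y j ∈ S} =
      Set.univ.pi fun k => if k ∈ ({i, j} : Finset ι) then S else Set.univ := by
    ext y
    simp only [Set.mem_ofPred_eq, Set.mem_univ_pi]
    constructor
    · rintro ⟨h1, h2⟩ k
      by_cases h : k ∈ ({i, j} : Finset ι)
      · rw [if_pos h]
        rcases Finset.mem_insert.1 h with rfl | h
        · exact h1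
        · rwa [Finset.mem_singleton.1 h]
      · simp [h]
    · intro h
      exact ⟨by simpa using h i, by simpa using h j⟩
  rw [this, Measure.pi_pi]
  simp only [apply_ite P, measure_univ]
  rw [Finset.prod_ite_mem, Finset.univ_inter, Finset.prod_const, Finset.card_pair hij]

/-- The square arises here: a minimum exceeds `t` iff both scores do, and distinct responses are
independent, so every pair contributes the same squared probability. -/
theorem lintegral_pairMeasure_Ioi {s : 𝒳 × 𝒴 → ℝ} (hs : Measurable s) (t : EReal) (x : 𝒳)
    (n : ℕ) :
    ∫⁻ y, pairMeasure s (x, ⟨n, y⟩) (Set.Ioi t) ∂Measure.pi (fun _ : Fin n => PY x) =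
      if 2 ≤ n then PY x {y | t < s (x, y)} ^ 2 else 0 := by
  split_ifs with hn
  · have hind : ∀ (y : Fin n → 𝒴) (p : Fin n × Fin n),
        Measure.dirac ((min (s (x, y p.1)) (s (x, y p.2)) : ℝ) : EReal) (Set.Ioi t) =
          Set.indicator {y : Fin n → 𝒴 | y p.1 ∈ {y | t < s (x, y)} ∧ y p.2 ∈ {y | t < s (x, y)}}
            1 y := by
      intro y p
      rw [Measure.dirac_apply' _ measurableSet_Ioi]
      simp only [Set.indicator, Set.mem_Ioi, Set.mem_ofPred_eq]
      congr 1
      rw [EReal.coe_strictMono.monotone.map_min, lt_min_iff]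
    have hS : MeasurableSet {y | t < s (x, y)} :=
      measurableSet_lt measurable_const (by fun_prop)
    have hS2 : ∀ p : Fin n × Fin n, MeasurableSet
        {y : Fin n → 𝒴 | y p.1 ∈ {y | t < s (x, y)} ∧ y p.2 ∈ {y | t < s (x, y)}} := fun p =>
      (hS.preimage (measurable_pi_apply p.1)).inter (hS.preimage (measurable_pi_apply p.2))
    simp only [pairMeasure_mk_apply, hind]
    rw [lintegral_finsetSum _ fun p _ => (measurable_one.indicator (hS2 p)).const_mul _]
    have h0 : (n.choose 2 : ℝ≥0∞) ≠ 0 := by exact_mod_cast (Nat.choose_pos hn).ne'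
    calc _ = ∑ p : Fin n × Fin n with p.1 < p.2,
          ((n.choose 2 : ℝ≥0∞)⁻¹) * PY x {y | t < s (x, y)} ^ 2 := by
          refine Finset.sum_congr rfl fun p hp => ?_
          rw [lintegral_const_mul _ (measurable_one.indicator (hS2 p)),
            lintegral_indicator_one (hS2 p), pi_const_apply_pair]
          exact (Finset.mem_filter.1 hp).2.ne
      _ = _ := by
          rw [Finset.sum_const, card_filter_lt, nsmul_eq_mul, ← mul_assoc,
            ENNReal.mul_inv_cancel h0 (ENNReal.natCast_ne_top _), one_mul]
  · have : ∀ y : Fin n → 𝒴, pairMeasure s (x, ⟨n, y⟩) (Set.Ioi t) = 0 := fun y => by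
      rw [pairMeasure_of_size_lt s (z := (x, ⟨n, y⟩)) hn]
      rfl
    simp [this]

theorem measurableSet_two_le_snd : MeasurableSet {p : 𝒳 × ℕ | 2 ≤ p.2} :=
  measurable_snd (measurableSet_Ici (a := 2))

/-- Multiplying by p_{≥2} replaces conditioning on N ≥ 2 by restriction to it. -/
theorem lintegral_featureLawTwo {g : 𝒳 → ℝ≥0∞} (hg : Measurable g) (hp : 0 < probTwo PX PN) :
    ENNReal.ofReal (probTwo PX PN) * ∫⁻ x, g x ∂featureLawTwo PX PN =
      ∫⁻ p, (if 2 ≤ p.2 then g p.1 else 0) ∂(PX ⊗ₘ PN) := by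
  have hpE : ENNReal.ofReal (probTwo PX PN) = (PX ⊗ₘ PN) {p | 2 ≤ p.2} := by
    simp [probTwo]
  have h0 : (PX ⊗ₘ PN) {p | 2 ≤ p.2} ≠ 0 := by
    rw [← hpE]
    simpa using hp
  rw [featureLawTwo, lintegral_map hg measurable_fst, ProbabilityTheory.cond,
    lintegral_smul_measure, hpE, smul_eq_mul, ← mul_assoc,
    ENNReal.mul_inv_cancel h0 (measure_ne_top _ _), one_mul,
    ← lintegral_indicator measurableSet_two_le_snd]
  simp [Set.indicator]

theorem groupLaw_two_le_size :
    groupLaw PX PN PY {z | 2 ≤ z.size} = ENNReal.ofReal (probTwo PX PN) := by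
  have hS : MeasurableSet {z : GroupData 𝒳 𝒴 | 2 ≤ z.size} :=
    measurable_size (measurableSet_Ici (a := 2))
  rw [← lintegral_indicator_one hS, lintegral_groupLaw _ _ _ (measurable_one.indicator hS)]
  have : ∀ (p : 𝒳 × ℕ) (y : Fin p.2 → 𝒴),
      Set.indicator {z : GroupData 𝒳 𝒴 | 2 ≤ z.size} (1 : GroupData 𝒳 𝒴 → ℝ≥0∞) (p.1, ⟨p.2, y⟩) =
        Set.indicator {p : 𝒳 × ℕ | 2 ≤ p.2} 1 p := fun p y => rfl
  simp only [this, lintegral_const, measure_univ, mul_one]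
  rw [lintegral_indicator_one measurableSet_two_le_snd]
  simp [probTwo]

theorem lintegral_numTwo (K : ℕ) :
    ∫⁻ w, (numTwo w : ℝ≥0∞) ∂Measure.pi (fun _ : Fin K => groupLaw PX PN PY) =
      K * ENNReal.ofReal (probTwo PX PN) := by
  have hS : MeasurableSet {z : GroupData 𝒳 𝒴 | 2 ≤ z.size} :=
    measurable_size (measurableSet_Ici (a := 2))
  have h : ∀ w : Fin K → GroupData 𝒳 𝒴, (numTwo w : ℝ≥0∞) =
      ∑ k, Set.indicator {z : GroupData 𝒳 𝒴 | 2 ≤ z.size} 1 (w k) := by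
    intro w
    rw [numTwo, Finset.card_filter, Nat.cast_sum]
    refine Finset.sum_congr rfl fun k _ => ?_
    simp [Set.indicator]
  have hm : Measurable (Set.indicator {z : GroupData 𝒳 𝒴 | 2 ≤ z.size} (1 : GroupData 𝒳 𝒴 → ℝ≥0∞)) :=
    measurable_one.indicator hS
  simp only [h]
  rw [lintegral_finsetSum _ fun k _ => by fun_prop]
  have : ∀ k : Fin K, ∫⁻ w, Set.indicator {z : GroupData 𝒳 𝒴 | 2 ≤ z.size} (1 : GroupData 𝒳 𝒴 → ℝ≥0∞) (w k)
      ∂Measure.pi (fun _ : Fin K => groupLaw PX PN PY) = ENNReal.ofReal (probTwo PX PN) := by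
    intro k
    rw [(measurePreserving_eval (fun _ : Fin K => groupLaw PX PN PY) k).lintegral_comp hm,
      lintegral_indicator_one hS, groupLaw_two_le_size]
  simp [this]

/-- Groups with fewer than two points have zero `pairMeasure`, so the unconditioned group law
performs the restriction to N ≥ 2 by itself. -/
theorem lintegral_groupLaw_pairMeasure_Ioi {s : 𝒳 × 𝒴 → ℝ} (hs : Measurable s) (t : EReal)
    (hp : 0 < probTwo PX PN) :
    ∫⁻ z, pairMeasure s z (Set.Ioi t) ∂groupLaw PX PN PY =
      ENNReal.ofReal (probTwo PX PN) *
        ∫⁻ x, PY x {y | t < s (x, y)} ^ 2 ∂featureLawTwo PX PN := by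
  have hS : MeasurableSet {q : 𝒳 × 𝒴 | t < s q} :=
    measurableSet_lt measurable_const (by fun_prop)
  have hg : Measurable fun x => PY x {y | t < s (x, y)} ^ 2 :=
    (Kernel.measurable_kernel_prodMk_left hS).pow_const 2
  have hm := (measurable_pairMeasure (A := Unit) (s := fun _ => s) (hs.comp measurable_snd)
    (S := Set.univ ×ˢ Set.Ioi t) (MeasurableSet.univ.prod measurableSet_Ioi)).comp
      (measurable_prodMk_left (x := ()))
  have hm' : Measurable fun z : GroupData 𝒳 𝒴 => pairMeasure s z (Set.Ioi t) := by
    convert hm using 2 with z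
    simp [Set.Ioi]
  rw [lintegral_groupLaw _ _ _ hm', lintegral_featureLawTwo PX PN hg hp]
  exact lintegral_congr fun p => lintegral_pairMeasure_Ioi PY hs t p.1 p.2

end Integrals

/-! ### Exchangeability, with the score function fixed -/

section FixedScore

variable {𝒳 𝒴 : Type*} [MeasurableSpace 𝒳] [MeasurableSpace 𝒴]
  (PX : Measure 𝒳) [IsProbabilityMeasure PX] (PN : Kernel 𝒳 ℕ) [IsMarkovKernel PN]
  (PY : Kernel 𝒳 𝒴) [IsMarkovKernel PY] {s : 𝒳 × 𝒴 → ℝ} {β : ℝ} {K₁ : ℕ}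

theorem measurable_quantile_calMeasure_const (hs : Measurable s) (hβ : β ≤ 1) :
    Measurable fun cal : Fin K₁ → GroupData 𝒳 𝒴 => quantile β (calMeasure s cal) := by
  have h : Measurable fun q : Unit × (Fin K₁ → GroupData 𝒳 𝒴) => quantile β (calMeasure s q.2) :=
    measurable_quantile_calMeasure (s := fun _ => s) (hs.comp measurable_snd) hβ
  exact h.comp (g := fun q : Unit × (Fin K₁ → GroupData 𝒳 𝒴) => quantile β (calMeasure s q.2))
    (f := fun cal => ((), cal)) (by fun_prop)

theorem measurable_pairMeasure_Ioi (hs : Measurable s) :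
    Measurable fun q : EReal × GroupData 𝒳 𝒴 => pairMeasure s q.2 (Set.Ioi q.1) :=
  measurable_pairMeasure (A := EReal) (s := fun _ => s) (hs.comp measurable_snd)
    (S := {q | q.1 < q.2}) (measurableSet_lt measurable_fst measurable_snd)

theorem measurable_pairMeasure_Ioi_quantile (hs : Measurable s) (hβ : β ≤ 1) :
    Measurable fun q : GroupData 𝒳 𝒴 × (Fin K₁ → GroupData 𝒳 𝒴) =>
      pairMeasure s q.1 (Set.Ioi (quantile β (calMeasure s q.2))) := by
  have hT : Measurable fun q : GroupData 𝒳 𝒴 × (Fin K₁ → GroupData 𝒳 𝒴) =>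
      quantile β (calMeasure s q.2) :=
    (measurable_quantile_calMeasure_const (K₁ := K₁) hs hβ).comp measurable_snd
  exact (measurable_pairMeasure_Ioi hs).comp
    (g := fun q : EReal × GroupData 𝒳 𝒴 => pairMeasure s q.2 (Set.Ioi q.1))
    (f := fun q : GroupData 𝒳 𝒴 × (Fin K₁ → GroupData 𝒳 𝒴) =>
      (quantile β (calMeasure s q.2), q.1)) (hT.prodMk measurable_fst)

/-- By exchangeability, any of `K₁ + 1` groups may play the role of the test group. -/
theorem lintegral_leaveOneOut (hs : Measurable s) (hβ : β ≤ 1) (hp : 0 < probTwo PX PN)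
    (j : Fin (K₁ + 1)) :
    ∫⁻ w, pairMeasure s (w j) (Set.Ioi (quantile β (calMeasure s fun i => w (j.succAbove i))))
        ∂Measure.pi (fun _ : Fin (K₁ + 1) => groupLaw PX PN PY) =
      ENNReal.ofReal (probTwo PX PN) *
        ∫⁻ cal, ∫⁻ x, PY x {y | quantile β (calMeasure s cal) < s (x, y)} ^ 2
          ∂featureLawTwo PX PN ∂Measure.pi (fun _ : Fin K₁ => groupLaw PX PN PY) := by
  have hm := measurable_pairMeasure_Ioi_quantile (K₁ := K₁) hs hβ
  have h := (measurePreserving_piFinSuccAbove (fun _ : Fin (K₁ + 1) => groupLaw PX PN PY)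
    j).lintegral_comp hm
  refine h.trans ?_
  -- Group `j` is integrated first, with the other groups and hence the threshold frozen.
  rw [lintegral_prod_symm' _ hm, ← lintegral_const_mul' _ _ ENNReal.ofReal_ne_top]
  exact lintegral_congr fun cal => lintegral_groupLaw_pairMeasure_Ioi PX PN PY hs (quantile β (calMeasure s cal)) hp

theorem sum_lintegral_leaveOneOut (hs : Measurable s) (hβ : β ≤ 1) (hp : 0 < probTwo PX PN) :
    ∫⁻ w, ∑ j : Fin (K₁ + 1), pairMeasure s (w j)
        (Set.Ioi (quantile β (calMeasure s fun i => w (j.succAbove i))))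
        ∂Measure.pi (fun _ : Fin (K₁ + 1) => groupLaw PX PN PY) =
      ((K₁ + 1 : ℕ) : ℝ≥0∞) * ENNReal.ofReal (probTwo PX PN) *
        ∫⁻ cal, ∫⁻ x, PY x {y | quantile β (calMeasure s cal) < s (x, y)} ^ 2
          ∂featureLawTwo PX PN ∂Measure.pi (fun _ : Fin K₁ => groupLaw PX PN PY) := by
  rw [lintegral_finsetSum]
  · simp only [lintegral_leaveOneOut PX PN PY hs hβ hp, Finset.sum_const, Finset.card_univ,
      Fintype.card_fin, nsmul_eq_mul, mul_assoc]
  · intro j _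
    exact (measurable_pairMeasure_Ioi_quantile hs hβ).comp (f := fun w : Fin (K₁ + 1) → _ =>
      (w j, fun i => w (j.succAbove i))) (by fun_prop)

theorem lintegral_sq_le (hs : Measurable s) (hβ : β ≤ 1) (hp : 0 < probTwo PX PN) :
    ∫⁻ cal, ∫⁻ x, PY x {y | quantile β (calMeasure s cal) < s (x, y)} ^ 2
          ∂featureLawTwo PX PN ∂Measure.pi (fun _ : Fin K₁ => groupLaw PX PN PY) ≤
      ENNReal.ofReal (1 - β) := by
  have h0 : ((K₁ + 1 : ℕ) : ℝ≥0∞) * ENNReal.ofReal (probTwo PX PN) ≠ 0 :=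
    mul_ne_zero (by simp) (by simpa using hp)
  have htop : ((K₁ + 1 : ℕ) : ℝ≥0∞) * ENNReal.ofReal (probTwo PX PN) ≠ ∞ :=
    ENNReal.mul_ne_top (ENNReal.natCast_ne_top _) ENNReal.ofReal_ne_top
  -- After scaling by (K₁ + 1) p_{≥2}, the mean of `numTwo`, both sides are integrals over K₁ + 1
  -- groups and compare pointwise.
  rw [← ENNReal.mul_le_mul_iff_right h0 htop, ← sum_lintegral_leaveOneOut PX PN PY hs hβ hp,
    ← lintegral_numTwo PX PN PY (K₁ + 1), ← lintegral_mul_const' _ _ ENNReal.ofReal_ne_top]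
  refine lintegral_mono fun w => ?_
  have h := ENNReal.ofReal_le_ofReal (sum_pairMeasure_Ioi_le s w hβ)
  rw [ENNReal.ofReal_mul (by positivity), ENNReal.ofReal_natCast,
    ENNReal.ofReal_sum_of_nonneg fun _ _ => measureReal_nonneg] at h
  simpa using h

/-- The hypothesis concerns K₁ + 1 groups because the test group joins the calibration groups. The
error is added on the right to avoid truncated subtraction. -/
theorem le_lintegral_sq_add (hs : Measurable s) (hβ₀ : 0 ≤ β) (hβ : β ≤ 1)
    (hp : 0 < probTwo PX PN)
    (hdist : ∀ᵐ w ∂Measure.pi (fun _ : Fin (K₁ + 1) => groupLaw PX PN PY),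
      ∀ i j, i ≠ j → ∀ a b, groupScores s (w i) a ≠ groupScores s (w j) b) :
    ENNReal.ofReal (1 - β) ≤
      ∫⁻ cal, ∫⁻ x, PY x {y | quantile β (calMeasure s cal) < s (x, y)} ^ 2
          ∂featureLawTwo PX PN ∂Measure.pi (fun _ : Fin K₁ => groupLaw PX PN PY) +
        ENNReal.ofReal (2 / (((K₁ : ℝ) + 1) * probTwo PX PN)) := by
  have h0 : ((K₁ + 1 : ℕ) : ℝ≥0∞) * ENNReal.ofReal (probTwo PX PN) ≠ 0 :=
    mul_ne_zero (by simp) (by simpa using hp)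
  have htop : ((K₁ + 1 : ℕ) : ℝ≥0∞) * ENNReal.ofReal (probTwo PX PN) ≠ ∞ :=
    ENNReal.mul_ne_top (ENNReal.natCast_ne_top _) ENNReal.ofReal_ne_top
  have h2 : ((K₁ + 1 : ℕ) : ℝ≥0∞) * ENNReal.ofReal (probTwo PX PN) *
      ENNReal.ofReal (2 / (((K₁ : ℝ) + 1) * probTwo PX PN)) = 2 := by
    rw [← ENNReal.ofReal_natCast, ← ENNReal.ofReal_mul (by positivity),
      ← ENNReal.ofReal_mul (by positivity)]
    push_cast
    rw [mul_div_cancel₀ _ (by positivity)]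
    simp
  rw [← ENNReal.mul_le_mul_iff_right h0 htop, mul_add, h2,
    ← sum_lintegral_leaveOneOut PX PN PY hs hβ hp,
    ← lintegral_numTwo PX PN PY (K₁ + 1), ← lintegral_mul_const' _ _ ENNReal.ofReal_ne_top]
  calc _ ≤ ∫⁻ w, (∑ j : Fin (K₁ + 1), pairMeasure s (w j)
        (Set.Ioi (quantile β (calMeasure s fun i => w (j.succAbove i)))) + 2)
        ∂Measure.pi (fun _ : Fin (K₁ + 1) => groupLaw PX PN PY) := by
        refine lintegral_mono_ae ?_
        filter_upwards [hdist] with w hw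
        have h := ENNReal.ofReal_le_ofReal
          (sub_le_iff_le_add.1 (le_sum_pairMeasure_Ioi s w hβ₀ hw))
        rw [ENNReal.ofReal_mul (by positivity), ENNReal.ofReal_natCast,
          ENNReal.ofReal_add (Finset.sum_nonneg fun _ _ => measureReal_nonneg) zero_le_two,
          ENNReal.ofReal_sum_of_nonneg fun _ _ => measureReal_nonneg] at h
        simpa using h
    _ = _ := by
        rw [lintegral_add_right _ measurable_const]
        simp

/-- Distinctness across `K₁ ≥ 2` groups passes to `K₁ + 1` groups: any two of the latter survive
the omission of a suitable third one. -/
theorem ae_groupScores_ne_succ (hK : 2 ≤ K₁)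
    (h : ∀ᵐ w ∂Measure.pi (fun _ : Fin K₁ => groupLaw PX PN PY),
      ∀ i j, i ≠ j → ∀ a b, groupScores s (w i) a ≠ groupScores s (w j) b) :
    ∀ᵐ w ∂Measure.pi (fun _ : Fin (K₁ + 1) => groupLaw PX PN PY),
      ∀ i j, i ≠ j → ∀ a b, groupScores s (w i) a ≠ groupScores s (w j) b := by
  have hl : ∀ l : Fin (K₁ + 1), ∀ᵐ w ∂Measure.pi (fun _ : Fin (K₁ + 1) => groupLaw PX PN PY),
      ∀ i j, i ≠ j → ∀ a b, groupScores s (w (l.succAbove i)) a ≠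
        groupScores s (w (l.succAbove j)) b := fun l =>
    (Measure.quasiMeasurePreserving_snd.comp (measurePreserving_piFinSuccAbove
      (fun _ : Fin (K₁ + 1) => groupLaw PX PN PY) l).quasiMeasurePreserving).ae h
  filter_upwards [ae_all_iff.2 hl] with w hw i j hij
  obtain ⟨l, hl⟩ : ∃ l, l ∉ ({i, j} : Finset (Fin (K₁ + 1))) := by
    by_contra! hall
    have h1 := Finset.card_le_card (fun l _ => hall l :
      (Finset.univ : Finset (Fin (K₁ + 1))) ⊆ {i, j})
    have h2 := Finset.card_le_two (a := i) (b := j)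
    simp only [Finset.card_univ, Fintype.card_fin] at h1
    omega
  simp only [Finset.mem_insert, Finset.mem_singleton, not_or] at hl
  obtain ⟨i', rfl⟩ := Fin.exists_succAbove_eq (Ne.symm hl.1)
  obtain ⟨j', rfl⟩ := Fin.exists_succAbove_eq (Ne.symm hl.2)
  exact hw l i' j' fun h => hij (h ▸ rfl)

end FixedScore

/-! ### Miscoverage as a conditional probability -/

section ConditionalProbability

variable {Ω V Y : Type*} [MeasurableSpace Ω] [MeasurableSpace V] [MeasurableSpace Y]

/-- Integrate over the sets `v ⁻¹' S`, which make up the conditioning σ-algebra, and disintegrate.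
The event `B` is joint because the prediction set depends on `v`. -/
theorem condExp_indicator_of_map_eq_compProd (μ : Measure Ω) [IsProbabilityMeasure μ]
    {v : Ω → V} (hv : Measurable v) {y : Ω → Y} (hy : Measurable y) (κ : Kernel V Y)
    [IsMarkovKernel κ] (h : μ.map (fun ω => (v ω, y ω)) = μ.map v ⊗ₘ κ) {B : Set (V × Y)}
    (hB : MeasurableSet B) :
    μ[Set.indicator {ω | (v ω, y ω) ∈ B} (fun _ => (1 : ℝ)) |
        MeasurableSpace.comap v inferInstance]
      =ᵐ[μ] fun ω => (κ (v ω)).real {b | (v ω, b) ∈ B} := by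
  have hE : MeasurableSet {ω | (v ω, y ω) ∈ B} := hB.preimage (hv.prodMk hy)
  have hκ : Measurable fun a => κ a {b | (a, b) ∈ B} := Kernel.measurable_kernel_prodMk_left hB
  have hκr : Measurable fun a => (κ a).real {b | (a, b) ∈ B} := hκ.ennreal_toReal
  have hint : Integrable (fun ω => (κ (v ω)).real {b | (v ω, b) ∈ B}) μ :=
    .of_bound (hκr.comp hv).aestronglyMeasurable 1 <| .of_forall fun ω => by
      rw [Real.norm_of_nonneg measureReal_nonneg]
      exact measureReal_le_one
  refine (ae_eq_condExp_of_forall_setIntegral_eq hv.comap_le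
    ((integrable_const 1).indicator hE) (fun _ _ _ => hint.integrableOn) ?_ ?_).symm
  · rintro _ ⟨S, hS, rfl⟩ -
    rw [setIntegral_indicator hE, setIntegral_const, smul_eq_mul, mul_one]
    rw [integral_eq_lintegral_of_nonneg_ae (.of_forall fun ω => measureReal_nonneg)
      (hκr.comp hv).aestronglyMeasurable, measureReal_def]
    congr 1
    have hSB : MeasurableSet (Prod.fst ⁻¹' S ∩ B) := (measurable_fst hS).inter hB
    have h1 : μ (v ⁻¹' S ∩ {ω | (v ω, y ω) ∈ B}) =
        (μ.map fun ω => (v ω, y ω)) (Prod.fst ⁻¹' S ∩ B) := by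
      rw [Measure.map_apply (hv.prodMk hy) hSB]
      rfl
    rw [h1, h, Measure.compProd_apply hSB,
      lintegral_map (Kernel.measurable_kernel_prodMk_left hSB) hv, ← lintegral_indicator (hv hS)]
    refine lintegral_congr fun ω => ?_
    by_cases hω : v ω ∈ S
    · rw [Set.indicator_of_mem (by exact hω), ofReal_measureReal]
      congr 1
      ext b
      simp [hω]
    · rw [Set.indicator_of_notMem (by exact hω), eq_comm]
      convert measure_empty (μ := κ (v ω))
      ext b
      simp [hω]
  · exact (hκr.comp (comap_measurable v)).stronglyMeasurable.aestronglyMeasurable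

/-- Independence lets the data join the conditioning without changing the kernel. -/
theorem map_prod_eq_compProd_of_indepFun {X D : Type*} [MeasurableSpace X] [MeasurableSpace D]
    (μ : Measure Ω) [IsProbabilityMeasure μ] {d : Ω → D} (hd : Measurable d) {x : Ω → X}
    (hx : Measurable x) {y : Ω → Y} (hy : Measurable y) (PX : Measure X) [IsProbabilityMeasure PX]
    (κ : Kernel X Y) [IsMarkovKernel κ] (hlaw : μ.map (fun ω => (x ω, y ω)) = PX ⊗ₘ κ)
    (hind : IndepFun d (fun ω => (x ω, y ω)) μ) :
    μ.map (fun ω => ((d ω, x ω), y ω)) =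
      μ.map (fun ω => (d ω, x ω)) ⊗ₘ κ.comap Prod.snd measurable_snd := by
  have hxlaw : μ.map x = PX := by
    have := congrArg (Measure.map Prod.fst) hlaw
    rwa [Measure.map_map measurable_fst (hx.prodMk hy), ← Measure.fst, Measure.fst_compProd]
      at this
  have hdx : μ.map (fun ω => (d ω, x ω)) = (μ.map d).prod PX := by
    have hi : IndepFun d x μ := hind.comp measurable_id measurable_fst
    rw [(indepFun_iff_map_prod_eq_prod_map_map hd.aemeasurable hx.aemeasurable).1 hi, hxlaw]
  have hdxy := (indepFun_iff_map_prod_eq_prod_map_map hd.aemeasurable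
    (hx.prodMk hy).aemeasurable).1 hind
  rw [hlaw] at hdxy
  have : IsProbabilityMeasure (μ.map d) := Measure.isProbabilityMeasure_map hd.aemeasurable
  have ha : Measurable fun q : D × X × Y => ((q.1, q.2.1), q.2.2) := by fun_prop
  have hcomp : μ.map (fun ω => ((d ω, x ω), y ω)) =
      (μ.map fun ω => (d ω, x ω, y ω)).map fun q => ((q.1, q.2.1), q.2.2) := by
    rw [Measure.map_map ha (by fun_prop)]
    rfl
  ext S hS
  rw [hcomp, hdxy, hdx, Measure.map_apply ha hS, Measure.prod_apply (ha hS),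
    Measure.compProd_apply hS, lintegral_prod _ (Kernel.measurable_kernel_prodMk_left hS).aemeasurable]
  refine lintegral_congr fun a => ?_
  rw [Measure.compProd_apply ((ha hS).preimage measurable_prodMk_left)]
  rfl

end ConditionalProbability

/-! ### Training and calibration parts of the data -/

section Split

variable {G : Type*} [MeasurableSpace G] {K₀ K₁ : ℕ}

theorem measurePreserving_split (ν : Measure G) [IsProbabilityMeasure ν] :
    MeasurePreserving
      (fun D : Fin (K₀ + K₁) → G => (fun k => D (Fin.castAdd K₁ k), fun k => D (Fin.natAdd K₀ k)))
      (Measure.pi fun _ => ν)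
      ((Measure.pi fun _ : Fin K₀ => ν).prod (Measure.pi fun _ : Fin K₁ => ν)) := by
  have h1 := (measurePreserving_piCongrLeft (α := fun _ => G) (fun _ : Fin (K₀ + K₁) => ν)
    finSumFinEquiv).symm
  have h2 := measurePreserving_sumPiEquivProdPi (X := fun _ : Fin K₀ ⊕ Fin K₁ => G) (fun _ => ν)
  exact h2.comp h1

end Split

theorem setOf_notMem_predSet {𝒳 𝒴 : Type*} {K₀ K₁ : ℕ} (α : ℝ) (fit : (Fin K₀ → GroupData 𝒳 𝒴) → 𝒳 × 𝒴 → ℝ)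
    (D : Fin (K₀ + K₁) → GroupData 𝒳 𝒴) (x : 𝒳) :
    {y | y ∉ predSet α fit D x} = {y | threshold α fit D < fit (trainPart D) (x, y)} := by
  ext y
  simp [predSet]

section Miscoverage

variable {𝒳 𝒴 : Type*} [MeasurableSpace 𝒳] [MeasurableSpace 𝒴] {K₀ K₁ : ℕ}
  {fit : (Fin K₀ → GroupData 𝒳 𝒴) → 𝒳 × 𝒴 → ℝ} {α : ℝ}

theorem measurable_trainPart :
    Measurable (trainPart : (Fin (K₀ + K₁) → GroupData 𝒳 𝒴) → Fin K₀ → GroupData 𝒳 𝒴) :=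
  measurable_pi_lambda _ fun _ => measurable_pi_apply _

theorem measurable_calPart :
    Measurable (calPart : (Fin (K₀ + K₁) → GroupData 𝒳 𝒴) → Fin K₁ → GroupData 𝒳 𝒴) :=
  measurable_pi_lambda _ fun _ => measurable_pi_apply _

theorem measurable_threshold (hfit : Measurable (Function.uncurry fit)) :
    Measurable fun D : Fin (K₀ + K₁) → GroupData 𝒳 𝒴 => threshold α fit D :=
  (measurable_quantile_calMeasure (K := K₁) hfit (β := 1 - α ^ 2)
    (by linarith [sq_nonneg α])).comp
    (g := fun q : (Fin K₀ → GroupData 𝒳 𝒴) × (Fin K₁ → GroupData 𝒳 𝒴) =>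
      quantile (1 - α ^ 2) (calMeasure (fit q.1) q.2))
    (f := fun D => (trainPart D, calPart D)) (measurable_trainPart.prodMk measurable_calPart)

theorem measurableSet_notMem_predSet (hfit : Measurable (Function.uncurry fit)) :
    MeasurableSet {q : ((Fin (K₀ + K₁) → GroupData 𝒳 𝒴) × 𝒳) × 𝒴 |
      q.2 ∉ predSet α fit q.1.1 q.1.2} := by
  have h : {q : ((Fin (K₀ + K₁) → GroupData 𝒳 𝒴) × 𝒳) × 𝒴 | q.2 ∉ predSet α fit q.1.1 q.1.2} =
      {q | threshold α fit q.1.1 < fit (trainPart q.1.1) (q.1.2, q.2)} := by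
    ext q
    simp [predSet]
  rw [h]
  have hs : Measurable fun q : ((Fin (K₀ + K₁) → GroupData 𝒳 𝒴) × 𝒳) × 𝒴 =>
      fit (trainPart q.1.1) (q.1.2, q.2) :=
    hfit.comp (f := fun q : ((Fin (K₀ + K₁) → GroupData 𝒳 𝒴) × 𝒳) × 𝒴 =>
      (trainPart q.1.1, (q.1.2, q.2))) ((measurable_trainPart.comp
        (measurable_fst.comp measurable_fst)).prodMk (by fun_prop))
  exact measurableSet_lt ((measurable_threshold hfit).comp (measurable_fst.comp measurable_fst))
    (measurable_coe_real_ereal.comp hs)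

theorem measurable_miscoverage (PY : Kernel 𝒳 𝒴) [IsMarkovKernel PY]
    (hfit : Measurable (Function.uncurry fit)) :
    Measurable fun q : (Fin (K₀ + K₁) → GroupData 𝒳 𝒴) × 𝒳 => miscoverage PY α fit q.1 q.2 :=
  (Kernel.measurable_kernel_prodMk_left (κ := PY.comap Prod.snd measurable_snd)
    (measurableSet_notMem_predSet hfit)).ennreal_toReal

theorem ofReal_miscoverage_sq (PY : Kernel 𝒳 𝒴) [IsMarkovKernel PY]
    (D : Fin (K₀ + K₁) → GroupData 𝒳 𝒴) (x : 𝒳) :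
    ENNReal.ofReal (miscoverage PY α fit D x ^ 2) =
      PY x {y | quantile (1 - α ^ 2) (calMeasure (fit (trainPart D)) (calPart D)) <
        fit (trainPart D) (x, y)} ^ 2 := by
  rw [miscoverage, setOf_notMem_predSet, ENNReal.ofReal_pow measureReal_nonneg,
    ofReal_measureReal]
  rfl

end Miscoverage

theorem crossDistinct_of_distinctScores {𝒳 𝒴 : Type*} {K₀ K₁ : ℕ}
    {fit : (Fin K₀ → GroupData 𝒳 𝒴) → 𝒳 × 𝒴 → ℝ} {D : Fin (K₀ + K₁) → GroupData 𝒳 𝒴}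
    (h : DistinctScores fit D) (i j : Fin K₁) (hij : i ≠ j) (a b) :
    groupScores (fit (trainPart D)) (calPart D i) a ≠
      groupScores (fit (trainPart D)) (calPart D j) b :=
  fun heq => hij (congrArg Sigma.fst (h (a₁ := ⟨i, a⟩) (a₂ := ⟨j, b⟩) heq))

/-! ### Integration over the training groups -/

section Calibration

variable {𝒳 𝒴 : Type*} [MeasurableSpace 𝒳] [MeasurableSpace 𝒴] {K₀ K₁ : ℕ}
  {fit : (Fin K₀ → GroupData 𝒳 𝒴) → 𝒳 × 𝒴 → ℝ} {α : ℝ}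

/-- Needed to transfer almost sure distinctness from Ω to the law of the data. -/
theorem measurableSet_crossDistinct (hfit : Measurable (Function.uncurry fit)) :
    MeasurableSet {q : (Fin K₀ → GroupData 𝒳 𝒴) × (Fin K₁ → GroupData 𝒳 𝒴) |
      ∀ i j, i ≠ j → ∀ a b, groupScores (fit q.1) (q.2 i) a ≠ groupScores (fit q.1) (q.2 j) b} := by
  refine measurableSet_setOfPred.2 (.forall fun i => .forall fun j => .forall fun _ => ?_)
  have h := measurableSet_setOfPred.1 (measurableSet_groupScores_ne hfit)
  exact h.comp (f := fun q : (Fin K₀ → GroupData 𝒳 𝒴) × (Fin K₁ → GroupData 𝒳 𝒴) =>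
    ((q.1, q.2 i), q.2 j)) (by fun_prop)

variable {Ω : Type*} [MeasurableSpace Ω] (μ : Measure Ω) [IsProbabilityMeasure μ]
  (PX : Measure 𝒳) [IsProbabilityMeasure PX] (PN : Kernel 𝒳 ℕ) [IsMarkovKernel PN]
  (PY : Kernel 𝒳 𝒴) [IsMarkovKernel PY] {Z : Fin (K₀ + K₁) → Ω → GroupData 𝒳 𝒴}

theorem measurePreserving_trainPart_calPart (hZ_meas : ∀ k, Measurable (Z k))
    (hZ_law : ∀ k, μ.map (Z k) = groupLaw PX PN PY) (hZ_indep : iIndepFun Z μ) :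
    MeasurePreserving (fun ω => (trainPart fun k => Z k ω, calPart fun k => Z k ω)) μ
      ((Measure.pi fun _ : Fin K₀ => groupLaw PX PN PY).prod
        (Measure.pi fun _ : Fin K₁ => groupLaw PX PN PY)) := by
  have hD : MeasurePreserving (fun ω k => Z k ω) μ
      (Measure.pi fun _ : Fin (K₀ + K₁) => groupLaw PX PN PY) := by
    refine ⟨measurable_pi_lambda _ hZ_meas, ?_⟩
    rw [(iIndepFun_iff_map_fun_eq_pi_map fun k => (hZ_meas k).aemeasurable).1 hZ_indep]
    simp only [hZ_law]
  exact (measurePreserving_split (groupLaw PX PN PY)).comp hD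

theorem isProbabilityMeasure_featureLawTwo (hp : 0 < probTwo PX PN) :
    IsProbabilityMeasure (featureLawTwo PX PN) := by
  have : IsProbabilityMeasure (ProbabilityTheory.cond (PX ⊗ₘ PN) {p | 2 ≤ p.2}) :=
    cond_isProbabilityMeasure fun h => by simp [probTwo, measureReal_def, h] at hp
  exact Measure.isProbabilityMeasure_map measurable_fst.aemeasurable

theorem integrable_miscoverage_sq (hfit : Measurable (Function.uncurry fit))
    (hZ_meas : ∀ k, Measurable (Z k)) (hp : 0 < probTwo PX PN) :
    Integrable (fun p : Ω × 𝒳 => miscoverage PY α fit (fun k => Z k p.1) p.2 ^ 2)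
      (μ.prod (featureLawTwo PX PN)) := by
  have := isProbabilityMeasure_featureLawTwo PX PN hp
  have hm : Measurable fun p : Ω × 𝒳 => ((fun k => Z k p.1 : Fin (K₀ + K₁) → _), p.2) :=
    (measurable_pi_lambda _ fun k => (hZ_meas k).comp measurable_fst).prodMk measurable_snd
  refine .of_bound
    (((measurable_miscoverage PY hfit).comp hm).pow_const 2).aestronglyMeasurable 1
    (.of_forall fun p => ?_)
  rw [Real.norm_of_nonneg (sq_nonneg _)]
  exact pow_le_one₀ measureReal_nonneg measureReal_le_one

/-- The second moment of the miscoverage, as an iterated integral over the training groups, the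
calibration groups and the test feature. -/
theorem ofReal_integral_miscoverage_sq (hfit : Measurable (Function.uncurry fit))
    (hZ_meas : ∀ k, Measurable (Z k)) (hZ_law : ∀ k, μ.map (Z k) = groupLaw PX PN PY)
    (hZ_indep : iIndepFun Z μ) (hp : 0 < probTwo PX PN) :
    ENNReal.ofReal (∫ p : Ω × 𝒳, miscoverage PY α fit (fun k => Z k p.1) p.2 ^ 2
        ∂(μ.prod (featureLawTwo PX PN))) =
      ∫⁻ d, ∫⁻ cal, ∫⁻ x,
        PY x {y | quantile (1 - α ^ 2) (calMeasure (fit d) cal) < fit d (x, y)} ^ 2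
          ∂featureLawTwo PX PN ∂Measure.pi (fun _ : Fin K₁ => groupLaw PX PN PY)
          ∂Measure.pi (fun _ : Fin K₀ => groupLaw PX PN PY) := by
  have := isProbabilityMeasure_featureLawTwo PX PN hp
  have hint := integrable_miscoverage_sq (α := α) μ PX PN PY hfit hZ_meas hp
  rw [ofReal_integral_eq_lintegral_ofReal hint (.of_forall fun p => sq_nonneg _),
    lintegral_prod _ hint.aemeasurable.ennreal_ofReal]
  simp only [ofReal_miscoverage_sq]
  have hS : MeasurableSet {q : (((Fin K₀ → GroupData 𝒳 𝒴) × (Fin K₁ → GroupData 𝒳 𝒴)) × 𝒳) × 𝒴 |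
      quantile (1 - α ^ 2) (calMeasure (fit q.1.1.1) q.1.1.2) < fit q.1.1.1 (q.1.2, q.2)} := by
    have hT := measurable_quantile_calMeasure (K := K₁) hfit (β := 1 - α ^ 2)
      (by linarith [sq_nonneg α])
    have hs : Measurable fun q :
        (((Fin K₀ → GroupData 𝒳 𝒴) × (Fin K₁ → GroupData 𝒳 𝒴)) × 𝒳) × 𝒴 =>
        fit q.1.1.1 (q.1.2, q.2) :=
      hfit.comp (f := fun q : (((Fin K₀ → GroupData 𝒳 𝒴) × (Fin K₁ → GroupData 𝒳 𝒴)) × 𝒳) × 𝒴 =>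
        (q.1.1.1, (q.1.2, q.2))) (by fun_prop)
    exact measurableSet_lt (hT.comp (measurable_fst.comp measurable_fst))
      (measurable_coe_real_ereal.comp hs)
  have hm := ((Kernel.measurable_kernel_prodMk_left
    (κ := PY.comap Prod.snd measurable_snd) hS).pow_const 2).lintegral_prod_right'
      (ν := featureLawTwo PX PN)
  exact ((measurePreserving_trainPart_calPart μ PX PN PY hZ_meas hZ_law hZ_indep).lintegral_comp
    hm).trans (lintegral_prod _ hm.aemeasurable)

theorem integral_miscoverage_sq_le (hfit : Measurable (Function.uncurry fit))
    (hZ_meas : ∀ k, Measurable (Z k)) (hZ_law : ∀ k, μ.map (Z k) = groupLaw PX PN PY)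
    (hZ_indep : iIndepFun Z μ) (hp : 0 < probTwo PX PN) :
    ∫ p : Ω × 𝒳, miscoverage PY α fit (fun k => Z k p.1) p.2 ^ 2
      ∂(μ.prod (featureLawTwo PX PN)) ≤ α ^ 2 := by
  refine (ENNReal.ofReal_le_ofReal_iff (sq_nonneg α)).1 ?_
  rw [ofReal_integral_miscoverage_sq μ PX PN PY hfit hZ_meas hZ_law hZ_indep hp]
  refine (lintegral_mono fun d => lintegral_sq_le PX PN PY
    (hfit.comp measurable_prodMk_left) (by linarith [sq_nonneg α]) hp).trans ?_
  simp

theorem le_integral_miscoverage_sq (hfit : Measurable (Function.uncurry fit))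
    (hZ_meas : ∀ k, Measurable (Z k)) (hZ_law : ∀ k, μ.map (Z k) = groupLaw PX PN PY)
    (hZ_indep : iIndepFun Z μ) (hp : 0 < probTwo PX PN) (hα₀ : 0 ≤ α) (hα₁ : α ≤ 1)
    (hdist : ∀ᵐ ω ∂μ, DistinctScores fit (fun k => Z k ω)) :
    α ^ 2 - 2 / (((K₁ : ℝ) + 1) * probTwo PX PN) ≤
      ∫ p : Ω × 𝒳, miscoverage PY α fit (fun k => Z k p.1) p.2 ^ 2
        ∂(μ.prod (featureLawTwo PX PN)) := by
  have hα2 : α ^ 2 ≤ 1 := pow_le_one₀ hα₀ hα₁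
  have hI : 0 ≤ ∫ p : Ω × 𝒳, miscoverage PY α fit (fun k => Z k p.1) p.2 ^ 2
      ∂(μ.prod (featureLawTwo PX PN)) := integral_nonneg fun p => sq_nonneg _
  -- For K₁ ≤ 1 distinctness among K₁ groups says nothing across K₁ + 1 groups, but then the error
  -- term is at least 1 ≥ α² and the bound is trivial.
  rcases Nat.lt_or_ge K₁ 2 with hK | hK
  · have hp1 : probTwo PX PN ≤ 1 := measureReal_le_one
    have hK' : (K₁ : ℝ) + 1 ≤ 2 := by exact_mod_cast (by omega : K₁ + 1 ≤ 2)
    have : 1 ≤ 2 / (((K₁ : ℝ) + 1) * probTwo PX PN) := by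
      rw [le_div_iff₀ (by positivity), one_mul]
      nlinarith
    linarith
  rw [sub_le_iff_le_add, ← ENNReal.ofReal_le_ofReal_iff (by positivity),
    ENNReal.ofReal_add hI (by positivity),
    ofReal_integral_miscoverage_sq μ PX PN PY hfit hZ_meas hZ_law hZ_indep hp]
  have hmp := measurePreserving_trainPart_calPart μ PX PN PY hZ_meas hZ_law hZ_indep
  have hprod : ∀ᵐ q ∂((Measure.pi fun _ : Fin K₀ => groupLaw PX PN PY).prod
      (Measure.pi fun _ : Fin K₁ => groupLaw PX PN PY)), ∀ i j, i ≠ j → ∀ a b,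
        groupScores (fit q.1) (q.2 i) a ≠ groupScores (fit q.1) (q.2 j) b := by
    rw [← hmp.map_eq, ae_map_iff hmp.measurable.aemeasurable (measurableSet_crossDistinct hfit)]
    filter_upwards [hdist] with ω hω
    exact crossDistinct_of_distinctScores hω
  calc ENNReal.ofReal (α ^ 2)
      = ∫⁻ _, ENNReal.ofReal (α ^ 2) ∂Measure.pi (fun _ : Fin K₀ => groupLaw PX PN PY) := by simp
    _ ≤ ∫⁻ d, ((∫⁻ cal, ∫⁻ x,
        PY x {y | quantile (1 - α ^ 2) (calMeasure (fit d) cal) < fit d (x, y)} ^ 2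
          ∂featureLawTwo PX PN ∂Measure.pi (fun _ : Fin K₁ => groupLaw PX PN PY)) +
        ENNReal.ofReal (2 / (((K₁ : ℝ) + 1) * probTwo PX PN)))
          ∂Measure.pi (fun _ : Fin K₀ => groupLaw PX PN PY) := by
        refine lintegral_mono_ae ?_
        -- For almost every training sample, the fixed score `fit d` separates the calibration
        -- groups almost surely.
        filter_upwards [Measure.ae_ae_of_ae_prod hprod] with d hd
        have h := le_lintegral_sq_add PX PN PY (s := fit d) (β := 1 - α ^ 2)
          (hfit.comp measurable_prodMk_left) (by linarith) (by linarith [sq_nonneg α]) hp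
          (ae_groupScores_ne_succ PX PN PY hK hd)
        rwa [sub_sub_cancel] at h
    _ = _ := by
        rw [lintegral_add_right _ measurable_const]
        simp

end Calibration

end HCP
end

theorem theorem2
    {𝒳 𝒴 Ω : Type*} [MeasurableSpace 𝒳] [MeasurableSpace 𝒴] [MeasurableSpace Ω]
    (μ : Measure Ω) [IsProbabilityMeasure μ]
    -- the distributions `P_X`, `P_{N|X}`, `P_{Y|X}`, with `p_{≥2} > 0`
    (PX : Measure 𝒳) [IsProbabilityMeasure PX]
    (PN : Kernel 𝒳 ℕ) [IsMarkovKernel PN]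
    (PY : Kernel 𝒳 𝒴) [IsMarkovKernel PY]
    (hp : 0 < HCP.probTwo PX PN)
    -- the i.i.d. groups `k = 1, …, K₀ + K₁`
    (K₀ K₁ : ℕ) (Z : Fin (K₀ + K₁) → Ω → HCP.GroupData 𝒳 𝒴)
    (hZ_meas : ∀ k, Measurable (Z k))
    (hZ_law : ∀ k, μ.map (Z k) = HCP.groupLaw PX PN PY)
    (hZ_indep : iIndepFun Z μ)
    -- the test point, independent of the groups
    (Xtest : Ω → 𝒳) (Ytest : Ω → 𝒴) (hX_meas : Measurable Xtest) (hY_meas : Measurable Ytest)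
    (htest_law : μ.map (fun ω => (Xtest ω, Ytest ω)) = PX ⊗ₘ PY)
    (htest_indep : IndepFun (fun ω k => Z k ω) (fun ω => (Xtest ω, Ytest ω)) μ)
    -- the score function, fitted on the first `K₀` groups, and the level
    (fit : (Fin K₀ → HCP.GroupData 𝒳 𝒴) → 𝒳 × 𝒴 → ℝ)
    (hfit : Measurable (Function.uncurry fit))
    (α : ℝ) (hα₀ : 0 ≤ α) (hα₁ : α ≤ 1) :
    -- `α_D(X_test)` is the conditional probability of miscoverage given `D` and `X_test`
    (μ[Set.indicator {ω | Ytest ω ∉ HCP.predSet α fit (fun k => Z k ω) (Xtest ω)} (fun _ => (1 : ℝ)) |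
        MeasurableSpace.comap (fun ω => ((fun k => Z k ω), Xtest ω)) inferInstance]
      =ᵐ[μ] fun ω => HCP.miscoverage PY α fit (fun k => Z k ω) (Xtest ω)) ∧
    -- second moment, with `D` as above and `X_test ∼ P_X^{≥2}` independent of `D`
    Integrable (fun p : Ω × 𝒳 => HCP.miscoverage PY α fit (fun k => Z k p.1) p.2 ^ 2)
      (μ.prod (HCP.featureLawTwo PX PN)) ∧
    ∫ p : Ω × 𝒳, HCP.miscoverage PY α fit (fun k => Z k p.1) p.2 ^ 2
      ∂(μ.prod (HCP.featureLawTwo PX PN)) ≤ α ^ 2 ∧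
    ((∀ᵐ ω ∂μ, HCP.DistinctScores fit (fun k => Z k ω)) →
      α ^ 2 - 2 / (((K₁ : ℝ) + 1) * HCP.probTwo PX PN) ≤
        ∫ p : Ω × 𝒳, HCP.miscoverage PY α fit (fun k => Z k p.1) p.2 ^ 2
          ∂(μ.prod (HCP.featureLawTwo PX PN))) := by
  have hD : Measurable fun ω k => Z k ω := measurable_pi_lambda _ hZ_meas
  refine ⟨?_, HCP.integrable_miscoverage_sq μ PX PN PY hfit hZ_meas hp,
    HCP.integral_miscoverage_sq_le μ PX PN PY hfit hZ_meas hZ_law hZ_indep hp,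
    HCP.le_integral_miscoverage_sq μ PX PN PY hfit hZ_meas hZ_law hZ_indep hp hα₀ hα₁⟩
  -- The conditioning variable is (D, X_test), and the kernel reads only its second coordinate.
  exact HCP.condExp_indicator_of_map_eq_compProd μ (hD.prodMk hX_meas) hY_meas
    (PY.comap Prod.snd measurable_snd)
    (HCP.map_prod_eq_compProd_of_indepFun μ hD hX_meas hY_meas PX PY htest_law htest_indep)
    (HCP.measurableSet_notMem_predSet hfit)
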